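/- Let $I=\{0,1\}$ and $\mathcal D=\bigoplus_{i\ge 0}\mathbb Z/2\mathbb Z$ with standard generators $g_i$, $i\ge0$; equip $\mathcal D$ with the finite subgroups $\mathcal D_n=\langle g_0,\dots,g_{n-1}\rangle$, $n\ge 1$. Write $\tau\colon\mathcal D\to I^{\mathbb N}$ for the embedding $\sum_i\alpha_i g_{i-1}\mapsto(\alpha_i)_{i\ge1}$ ($I^{\mathbb N}$ with coordinatewise addition mod 2), let $\mathcal D$ act on $I^{\mathcal D}\times I^{\mathbb N}$ by $\operatorname{diag}(g)(w,\alpha)=(w(\cdot+g),\alpha+\tau(g))$, and let $m$ be the uniform Bernoulli (Lebesgue) measure on $I^{\mathbb N}$. For a sequence $\sigma=(\sigma_i)_{i\ge0}$ of zeros and ones put $\mathcal D^\sigma=\langle g_i:\sigma_i=0\rangle$, let $m^\sigma$ be the pushforward of the uniform Bernoulli measure on $I^{\mathcal D/\mathcal D^\sigma}$ under the map $I^{\mathcal D/\mathcal D^\sigma}\to I^{\mathcal D}$ induced by the quotient map $\mathcal D\to\mathcal D/\mathcal D^\sigma$, and put $\omega^\sigma=m^\sigma\times m$. The graph of ordered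 pairs $\mathrm{OP}$ has the floors $\mathrm{OP}_0=I$, $\mathrm{OP}_{n+1}=\mathrm{OP}_n\times\mathrm{OP}_n$; every vertex $v=(v_0,v_1)\in\mathrm{OP}_{n+1}$ is entered by exactly two edges, one from $v_0$ with index $0$ and one from $v_1$ with index $1$. Let $\mathcal T(\mathrm{OP})$ be the space of infinite paths starting on floor $0$, with the Borel $\sigma$-algebra generated by the cylinders. The canonical action $\kappa$ of $\mathcal D$ on $\mathcal T(\mathrm{OP})$ is determined by: $\kappa(g_n)x$ coincides with $x$ from floor $n+1$ on, the index of its edge entering floor $n+1$ is the opposite one, and its edges between floors $i$ and $i+1$, $i<n$, have the same indices as those of $x$. Label the vertices by configurations, $\Phi[v]\in I^{\mathcal D_n}$ for $v\in\mathrm{OP}_n$: $\Phi[v](0)=v$ for $v\in \mathrm{OP}_0$, and for $v=(v_0,v_1)\in\mathrm{OP}_{n+1}$ put $\Phi[v](h)=\Phi[v_0](h)$ if $h\in\mathcal D_n$ and $\Phi[v](h)=\Phi[v_1](g_n+h)$ if $h\in\mathcal D_{n+1}\setminus\mathcal D_n$. For a path $x$ with vertices $v_n$, let $\alpha_n$,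 $n\ge1$, be the index of its edge entering floor $n$, and let $F[x]\in I^{\mathcal D}$ be given by $F[x](g)=\Phi[v_n]\bigl(g+\sum_{i=0}^{n-1}\alpha_{i+1}g_i\bigr)$ for $g\in\mathcal D_n$ (this does not depend on $n$). The map $\Psi(x)=(F[x],(\alpha_n)_{n\ge1})$ is a bijection $\mathcal T(\mathrm{OP})\to I^{\mathcal D}\times I^{\mathbb N}$; let $\mu^\sigma$ be the pushforward of $\omega^\sigma$ under $\Psi^{-1}$. For a probability space $(X,\mu)$, a semimetric $\rho$ on $X$ and $\varepsilon>0$, let $\mathbb H_\varepsilon(X,\mu,\rho)$ be the binary logarithm of the least positive integer $k$ such that $X$ can be partitioned into measurable sets $X_0,\dots,X_k$ with $\mu(X_0)<\varepsilon$ and with $X_1,\dots,X_k$ of $\rho$-diameter less than $\varepsilon$ ($+\infty$ if there is none). A summable admissible metric is a semimetric $\rho\in L^1(X^2,\mu^2)$ such that, on some set of full measure, $\rho$ is separable and is a metric. Let a group $G$ with finite subsets $G_n\subset G$, $n\ge 1$, act on $(X,\mu)$ by measure-preserving transformations. A sequence $(h_n)_{n\ge1}$ of positive numbers is a scaling sequence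 of this action if for some, and for every, summable admissible metric $\rho$ the following holds: for all sufficiently small $\varepsilon>0$, $$0<\liminf_{n\to\infty}\frac{\mathbb H_\varepsilon\bigl(X,\mu,\rho_n\bigr)}{h_n}\le\limsup_{n\to\infty}\frac{\mathbb H_\varepsilon\bigl(X,\mu,\rho_n\bigr)}{h_n}<\infty,\qquad \rho_n(x,y)=\frac1{|G_n|}\sum_{g\in G_n}\rho(gx,gy).$$ Then for every sequence $\sigma=(\sigma_i)_{i\ge 0}$ of zeros and ones, the sequence $h_n=2^{\sigma_0+\dots+\sigma_{n-1}}$, $n\ge1$, is a scaling sequence of the action $\operatorname{diag}$ of $\mathcal D$, with the equipment $\mathcal D_n$, on $(I^{\mathcal D}\times I^{\mathbb N},\omega^\sigma)$, and also of the canonical action $\kappa$ of $\mathcal D$, with the same equipment, on $(\mathcal T(\mathrm{OP}),\mu^\sigma)$. -/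

import Mathlib

open MeasureTheory Filter

noncomputable section

/-! ## Semimetrics, `ε`-entropy and scaling sequences of equipped group actions -/

section Scaling

/-- `ρ` is a semimetric on `X` (distinct points may be at distance zero). -/
structure IsSemimetric {X : Type*} (ρ : X → X → ℝ) : Prop where
  nonneg : ∀ x y, 0 ≤ ρ x y
  self : ∀ x, ρ x x = 0
  symm : ∀ x y, ρ x y = ρ y x
  triangle : ∀ x y z, ρ x z ≤ ρ x y + ρ y z

/-- `ρ` is separable on the set `X₀`: some countable subset of `X₀` is `ρ`-dense in `X₀`. -/
def SeparableOn {X : Type*} (ρ : X → X → ℝ) (X₀ : Set X) : Prop :=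
  ∃ S : Set X, S.Countable ∧ S ⊆ X₀ ∧ ∀ x ∈ X₀, ∀ δ : ℝ, 0 < δ → ∃ s ∈ S, ρ x s < δ

/-- `ρ` is an admissible metric on `(X, μ)`: a semimetric, measurable with respect to (the
completion of) `μ × μ`, which on some set of full measure is separable and is a metric. -/
structure IsAdmissibleMetric {X : Type*} [MeasurableSpace X] (μ : Measure X)
    (ρ : X → X → ℝ) : Prop where
  semimetric : IsSemimetric ρ
  measurable : AEMeasurable (fun p : X × X => ρ p.1 p.2) (μ.prod μ)
  exists_full : ∃ X₀ : Set X, μ X₀ᶜ = 0 ∧ SeparableOn ρ X₀ ∧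
    ∀ x ∈ X₀, ∀ y ∈ X₀, ρ x y = 0 → x = y

/-- `ρ` is an admissible metric on `(X, μ)` which is summable with respect to `μ × μ`. -/
structure IsSummableAdmissibleMetric {X : Type*} [MeasurableSpace X] (μ : Measure X)
    (ρ : X → X → ℝ) : Prop extends IsAdmissibleMetric μ ρ where
  summable : Integrable (fun p : X × X => ρ p.1 p.2) (μ.prod μ)

/-- `X` can be partitioned into sets `A 0, …, A k`, measurable with respect to (the completion of)
`μ`, such that `μ (A 0) < ε` and `A 1, …, A k` have `ρ`-diameter less than `ε`. -/
def HasSmallPartition {X : Type*} [MeasurableSpace X] (μ : Measure X) (ρ : X → X → ℝ)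
    (ε : ℝ) (k : ℕ) : Prop :=
  ∃ A : Fin (k + 1) → Set X,
    (∀ j, NullMeasurableSet (A j) μ) ∧
    Pairwise (fun i j => Disjoint (A i) (A j)) ∧
    (⋃ j, A j) = Set.univ ∧
    μ (A 0) < ENNReal.ofReal ε ∧
    ∀ j, j ≠ 0 → ∃ d : ℝ, d < ε ∧ ∀ x ∈ A j, ∀ y ∈ A j, ρ x y ≤ d

/-- The `ε`-entropy of `(X, μ, ρ)`: the binary logarithm of the smallest positive integer `k` for
which `HasSmallPartition μ ρ ε k` holds, and `⊤` if there is none. -/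
def epsEntropy {X : Type*} [MeasurableSpace X] (μ : Measure X) (ρ : X → X → ℝ) (ε : ℝ) :
    ENNReal :=
  ⨅ (k : ℕ) (_ : 0 < k ∧ HasSmallPartition μ ρ ε k), ENNReal.ofReal (Real.logb 2 k)

/-- The averaging of `ρ` over the shifts by the elements of the finite set `S`. -/
def averageOver {G X : Type*} [VAdd G X] (S : Finset G) (ρ : X → X → ℝ) : X → X → ℝ :=
  fun x y => (S.card : ℝ)⁻¹ * ∑ g ∈ S, ρ (g +ᵥ x) (g +ᵥ y)

/-- `a n ≍ h n` as `n → ∞`, for a sequence `h` of positive numbers. -/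
def AsympEquiv (a : ℕ → ENNReal) (h : ℕ → ℝ) : Prop :=
  0 < liminf (fun n => a n / ENNReal.ofReal (h n)) atTop ∧
    limsup (fun n => a n / ENNReal.ofReal (h n)) atTop < ⊤

/-- `h` is a scaling sequence for the semimetric `ρ`, with respect to the action on `(X, μ)` of the
group `G` with equipment `E n`, `n ≥ 1`. -/
def IsScalingFor {G X : Type*} [AddGroup G] [AddAction G X] [MeasurableSpace X]
    (μ : Measure X) (E : ℕ → Finset G) (ρ : X → X → ℝ) (h : ℕ → ℝ) : Prop :=
  ∃ ε₀ : ℝ, 0 < ε₀ ∧ ∀ ε : ℝ, 0 < ε → ε < ε₀ →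
    AsympEquiv (fun n => epsEntropy μ (averageOver (E n) ρ) ε) h

/-- `h` (a sequence `h n`, `n ≥ 1`) is a scaling sequence of the measure-preserving action on
`(X, μ)` of the group `G` with equipment `E n`, `n ≥ 1`: it is scaling for some, and for every,
summable admissible metric. -/
structure IsScalingSequence {G X : Type*} [AddGroup G] [AddAction G X] [MeasurableSpace X]
    (μ : Measure X) (E : ℕ → Finset G) (h : ℕ → ℝ) : Prop where
  measurePreserving : ∀ g : G, MeasurePreserving (fun x : X => g +ᵥ x) μ μ
  pos : ∀ n, 1 ≤ n → 0 < h n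
  exists_metric : ∃ ρ : X → X → ℝ, IsSummableAdmissibleMetric μ ρ
  scaling : ∀ ρ : X → X → ℝ, IsSummableAdmissibleMetric μ ρ → IsScalingFor μ E ρ h

end Scaling

namespace OrderedPairs

/-! ## The group `𝒟` and its equipment -/

/-- The group `𝒟`, the direct sum of countably many copies of `ℤ/2ℤ`. -/
abbrev D : Type := ℕ →₀ ZMod 2

/-- The generators `g_i` of `𝒟`. -/
def gen (i : ℕ) : D := Finsupp.single i 1

/-- The finite subgroup `𝒟_n`, generated by `g_0, …, g_{n-1}`. -/
def subD (n : ℕ) : AddSubgroup D := AddSubgroup.closure {g | ∃ i, i < n ∧ g = gen i}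

theorem apply_eq_zero_of_mem_subD {n : ℕ} {g : D} (hg : g ∈ subD n) :
    ∀ i, n ≤ i → g i = 0 := by
  refine AddSubgroup.closure_induction (p := fun g _ => ∀ i, n ≤ i → g i = 0) ?_ ?_ ?_ ?_ hg
  · rintro _ ⟨j, hj, rfl⟩ i hi
    have : j ≠ i := by omega
    simp [gen, this]
  · intro i _
    rfl
  · intro x y _ _ hx hy i hi
    simp [hx i hi, hy i hi]
  · intro x _ hx i hi
    simp [hx i hi]

theorem finite_subD (n : ℕ) : (subD n : Set D).Finite := by
  refine Set.Finite.of_injOn (f := fun g : D => fun i : Fin n => g i)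
    (t := (Set.univ : Set (Fin n → ZMod 2))) (fun _ _ => Set.mem_univ _) ?_ Set.finite_univ
  intro g hg h hh hgh
  ext i
  by_cases hi : i < n
  · exact congrFun hgh ⟨i, hi⟩
  · rw [apply_eq_zero_of_mem_subD hg i (by omega), apply_eq_zero_of_mem_subD hh i (by omega)]

/-- The equipment `𝒟_n` of the group `𝒟`. -/
def equipD (n : ℕ) : Finset D := (finite_subD n).toFinset

/-- A bound for the support of `g`: `g i = 0` for `i ≥ len g`, that is, `g ∈ 𝒟_{len g}`. -/
def len (g : D) : ℕ := g.support.sup (fun i => i + 1)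

theorem apply_eq_zero_of_len_le {g : D} {i : ℕ} (h : len g ≤ i) : g i = 0 := by
  by_contra hne
  have : i + 1 ≤ len g :=
    Finset.le_sup (f := fun i => i + 1) (Finsupp.mem_support_iff.2 hne)
  omega

theorem zmod_add_self (a : ZMod 2) : a + a = 0 := by
  revert a
  decide

theorem add_self (g : D) : g + g = 0 := by
  ext i
  simp [zmod_add_self]

/-! ## The diagonal action and the measures `ω^σ` -/

/-- Configurations on `𝒟`. -/
abbrev Config : Type := D → ZMod 2

/-- Infinite sequences of zeros and ones. The terms are numbered from `0` here: the term
`α_{i+1}` in the usual numbering `α_1, α_2, …` is `α i`. -/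
abbrev BinSeq : Type := ℕ → ZMod 2

/-- The embedding `τ` of `𝒟` into the group of infinite sequences. -/
def tau (g : D) : BinSeq := fun i => g i

/-- The action `diag` of `𝒟`: `diag g (w, α) = (w (· + g), α + τ g)`. -/
instance diagAction : AddAction D (Config × BinSeq) where
  vadd g p := (fun h => p.1 (h + g), p.2 + tau g)
  zero_vadd p := by
    refine Prod.ext ?_ ?_
    · funext h
      exact congrArg p.1 (add_zero h)
    · funext i
      exact add_zero (p.2 i)
  add_vadd g g' p := by
    refine Prod.ext ?_ ?_
    · funext h
      exact congrArg p.1 (add_assoc h g g').symm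
    · funext i
      change p.2 i + (g i + g' i) = p.2 i + g' i + g i
      ring

/-- The uniform measure on `{0, 1}`. -/
def coin : Measure (ZMod 2) := (PMF.uniformOfFintype (ZMod 2)).toMeasure

instance : IsProbabilityMeasure coin := by
  unfold coin
  infer_instance

/-- The Lebesgue (Bernoulli) measure on `{0, 1}^ι`. -/
def lebesgue (ι : Type) : Measure (ι → ZMod 2) := Measure.infinitePi (fun _ : ι => coin)

/-- The subgroup `𝒟^σ` generated by the `g_i` with `σ_i = 0`. -/
def subDSigma (σ : ℕ → Fin 2) : AddSubgroup D :=
  AddSubgroup.closure {g | ∃ i, σ i = 0 ∧ g = gen i}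

/-- The measure `m^σ` on configurations: the pushforward of the Lebesgue measure under the map of
configurations induced by the quotient map `𝒟 → 𝒟 / 𝒟^σ`. -/
def mSigma (σ : ℕ → Fin 2) : Measure Config :=
  (lebesgue (D ⧸ subDSigma σ)).map (fun u g => u (QuotientAddGroup.mk g))

/-- The measure `ω^σ`. -/
def omegaSigma (σ : ℕ → Fin 2) : Measure (Config × BinSeq) :=
  (mSigma σ).prod (lebesgue ℕ)

/-! ## The graph of ordered pairs and its path space -/

/-- The vertices on floor `n` of the graph of ordered pairs. -/
def Vertex : ℕ → Type
  | 0 => ZMod 2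
  | n + 1 => Vertex n × Vertex n

/-- The initial vertex of the edge with index `β` entering the vertex `v = (v_0, v_1)`. An edge of
the graph is determined by its end and its index. -/
def source {n : ℕ} (v : Vertex (n + 1)) (β : ZMod 2) : Vertex n :=
  if β = 0 then Prod.fst (α := Vertex n) (β := Vertex n) v
  else Prod.snd (α := Vertex n) (β := Vertex n) v

/-- The infinite paths of the graph of ordered pairs, starting on floor `0`. Such a path is given
by its vertices and by the indices of its edges; `index n` is the index of the edge that joins
`vertex n` to `vertex (n + 1)`. -/
@[ext]
structure PathSpace : Type where
  vertex : (n : ℕ) → Vertex n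
  index : BinSeq
  source_eq : ∀ n, source (vertex (n + 1)) (index n) = vertex n

instance (n : ℕ) : MeasurableSpace (Vertex n) := ⊤

/-- The Borel `σ`-algebra of the path space, which is generated by the cylinders: the coarsest one
for which all vertices and all edges of a path are measurable. -/
instance : MeasurableSpace PathSpace :=
  MeasurableSpace.comap (fun x : PathSpace => (x.vertex, x.index)) inferInstance

theorem PathSpace.eq_of_eventually {x y : PathSpace} (hi : x.index = y.index) (N : ℕ)
    (hv : ∀ n, N ≤ n → x.vertex n = y.vertex n) : x = y := by
  refine PathSpace.ext ?_ hi
  have key : ∀ k n, N ≤ n + k → x.vertex n = y.vertex n := by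
    intro k
    induction k with
    | zero => exact fun n hn => hv n hn
    | succ k ih =>
      intro n hn
      rw [← x.source_eq n, ← y.source_eq n, hi, ih (n + 1) (by omega)]
  funext n
  exact key N n (by omega)

/-! ## The canonical action -/

/-- Keep the vertices on the floors `≥ N` and replace those on the floors `N - 1, …, 0`, in this
order, by going down from floor `N` along the edges with indices `β (N - 1), …, β 0`. -/
def reroute (β : BinSeq) : ℕ → ((n : ℕ) → Vertex n) → ((n : ℕ) → Vertex n)
  | 0, u => u
  | N + 1, u => reroute β N (Function.update u N (source (u (N + 1)) (β N)))

theorem reroute_of_le (β : BinSeq) (N : ℕ) (u : (n : ℕ) → Vertex n) (n : ℕ) (h : N ≤ n) :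
    reroute β N u n = u n := by
  induction N generalizing u with
  | zero => rfl
  | succ N ih =>
    have hne : n ≠ N := by omega
    rw [reroute, ih _ (by omega), Function.update_of_ne hne]

theorem source_reroute (β : BinSeq) (N : ℕ) (u : (n : ℕ) → Vertex n) (n : ℕ) (h : n < N) :
    source (reroute β N u (n + 1)) (β n) = reroute β N u n := by
  induction N generalizing u with
  | zero => omega
  | succ N ih =>
    rcases Nat.lt_succ_iff_lt_or_eq.1 h with h | rfl
    · exact ih _ h
    · rw [reroute, reroute_of_le _ _ _ _ (Nat.le_succ n), reroute_of_le _ _ _ _ le_rfl,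
        Function.update_self, Function.update_of_ne (by omega)]

/-- The path `κ(g) x`: the edges have the indices of the edges of `x` changed by `τ g`, and from
some floor on the path coincides with `x`. -/
def kappa (g : D) (x : PathSpace) : PathSpace where
  vertex := reroute (x.index + tau g) (len g) x.vertex
  index := x.index + tau g
  source_eq n := by
    by_cases h : n < len g
    · exact source_reroute _ _ _ _ h
    · have hg : (x.index + tau g) n = x.index n := by
        simp [tau, apply_eq_zero_of_len_le (not_lt.1 h)]
      rw [reroute_of_le _ _ _ _ (by omega), reroute_of_le _ _ _ _ (by omega), hg, x.source_eq]

theorem kappa_vertex_of_le (g : D) (x : PathSpace) (n : ℕ) (h : len g ≤ n) :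
    (kappa g x).vertex n = x.vertex n :=
  reroute_of_le _ _ _ _ h

theorem kappa_index (g : D) (x : PathSpace) : (kappa g x).index = x.index + tau g := rfl

/-- The canonical action `κ` of `𝒟` on the path space. -/
instance canonicalAction : AddAction D PathSpace where
  vadd := kappa
  zero_vadd x := by
    refine PathSpace.eq_of_eventually (?_ : x.index + tau 0 = x.index) (len 0)
      (fun n hn => kappa_vertex_of_le 0 x n hn)
    funext i
    exact add_zero (x.index i)
  add_vadd g h x := by
    refine PathSpace.eq_of_eventually
      (?_ : x.index + tau (g + h) = x.index + tau h + tau g) (len (g + h) + len g + len h) ?_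
    · funext i
      change x.index i + (g i + h i) = x.index i + h i + g i
      ring
    · intro n hn
      exact (kappa_vertex_of_le (g + h) x n (by omega)).trans
        ((kappa_vertex_of_le g (kappa h x) n (by omega)).trans
          (kappa_vertex_of_le h x n (by omega))).symm

/-- On the generators the action is as described in words: `κ(g_m) x` coincides with `x` from floor
`m + 1` on, the index of the edge entering floor `m + 1` is changed, and the other indices are
kept. -/
theorem gen_vadd_spec (m : ℕ) (x : PathSpace) :
    (∀ n, m + 1 ≤ n → (gen m +ᵥ x).vertex n = x.vertex n) ∧
      (gen m +ᵥ x).index m = x.index m + 1 ∧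
      ∀ n, n ≠ m → (gen m +ᵥ x).index n = x.index n := by
  have hl : len (gen m) = m + 1 := by
    simp [len, gen]
  refine ⟨fun n hn => kappa_vertex_of_le _ _ _ (by omega), ?_, fun n hn => ?_⟩
  · change x.index m + gen m m = _
    simp [gen]
  · change x.index n + gen m n = _
    simp [gen, Finsupp.single_eq_of_ne hn]

/-! ## The isomorphism `Ψ` and the measures `μ^σ` -/

/-- The configuration `Φ[v]` on `𝒟_n` that labels a vertex `v` on floor `n`. It is written as a
function on all of `𝒟` which ignores the coordinates with numbers `≥ n` of its argument; for
`h ∈ 𝒟_{n+1}` the condition `h n = 0` means that `h ∈ 𝒟_n`. -/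
def Phi : (n : ℕ) → Vertex n → Config
  | 0, v => fun _ => v
  | n + 1, v => fun h =>
    if h n = 0 then Phi n (Prod.fst (α := Vertex n) (β := Vertex n) v) h
    else Phi n (Prod.snd (α := Vertex n) (β := Vertex n) v) (gen n + h)

/-- The sum `α_1 g_0 + … + α_n g_{n-1}`. -/
def partialSum (α : BinSeq) (n : ℕ) : D := ∑ i ∈ Finset.range n, Finsupp.single i (α i)

/-- The map `F` from paths to configurations: `F[x](g) = Φ[v_n](g + α_1 g_0 + … + α_n g_{n-1})` for
`g ∈ 𝒟_n`; the value does not depend on such an `n` by `F_eq` below. -/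
def F (x : PathSpace) : Config := fun g =>
  Phi (len g) (x.vertex (len g)) (g + partialSum x.index (len g))

/-- The map `Ψ = (F, A)`, where `A[x]` is the sequence of the indices of the edges of `x`. -/
def psi (x : PathSpace) : Config × BinSeq := (F x, x.index)

theorem partialSum_apply_of_lt (α : BinSeq) {n i : ℕ} (h : i < n) : partialSum α n i = α i := by
  simp only [partialSum, Finsupp.finsetSum_apply, Finsupp.single_apply]
  simp [h]

theorem partialSum_apply_of_le (α : BinSeq) {n i : ℕ} (h : n ≤ i) : partialSum α n i = 0 := by
  simp only [partialSum, Finsupp.finsetSum_apply, Finsupp.single_apply]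
  simp [h]

theorem Phi_congr (n : ℕ) (v : Vertex n) {h h' : D} (hh : ∀ i, i < n → h i = h' i) :
    Phi n v h = Phi n v h' := by
  induction n generalizing h h' with
  | zero => rfl
  | succ n ih =>
    simp only [Phi]
    rw [hh n (by omega), ih _ (fun i hi => hh i (by omega)),
      ih (Prod.snd (α := Vertex n) (β := Vertex n) v) (h := gen n + h) (h' := gen n + h')
        (fun i hi => by simp [hh i (by omega : i < n + 1)])]

theorem Phi_succ (n : ℕ) (v : Vertex (n + 1)) (h : D) :
    Phi (n + 1) v h = Phi n (source v (h n)) h := by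
  simp only [Phi, source]
  split_ifs with h0
  · rfl
  · refine Phi_congr n _ (fun i hi => ?_)
    have : n ≠ i := by omega
    simp [gen, this]

theorem F_eq (x : PathSpace) (g : D) (n : ℕ) (hn : len g ≤ n) :
    F x g = Phi n (x.vertex n) (g + partialSum x.index n) := by
  induction n, hn using Nat.le_induction with
  | base => rfl
  | succ n hn ih =>
    rw [ih, Phi_succ]
    have : (g + partialSum x.index (n + 1)) n = x.index n := by
      rw [Finsupp.add_apply, apply_eq_zero_of_len_le hn, partialSum_apply_of_lt _ (by omega),
        zero_add]
    rw [this, x.source_eq]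
    refine Phi_congr n _ (fun i hi => ?_)
    simp [partialSum_apply_of_lt x.index hi, partialSum_apply_of_lt x.index (by omega : i < n + 1)]

/-- The inverse of `Φ` on floor `n`. -/
def PhiInv : (n : ℕ) → Config → Vertex n
  | 0, c => c 0
  | n + 1, c => (PhiInv n c, PhiInv n (fun h => c (h + gen n)))

theorem PhiInv_congr (n : ℕ) {c c' : Config} (hc : ∀ h : D, (∀ i, n ≤ i → h i = 0) → c h = c' h) :
    PhiInv n c = PhiInv n c' := by
  induction n generalizing c c' with
  | zero => exact hc 0 (fun _ _ => rfl)
  | succ n ih =>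
    refine Prod.ext (ih (fun h hh => hc h (fun i hi => hh i (by omega))))
      (ih (fun h hh => hc _ (fun i hi => ?_)))
    have : n ≠ i := by omega
    simp [gen, this, hh i (by omega)]

theorem PhiInv_Phi (n : ℕ) (v : Vertex n) : PhiInv n (Phi n v) = v := by
  induction n with
  | zero => rfl
  | succ n ih =>
    refine Prod.ext ?_ ?_
    · refine (PhiInv_congr n (c' := Phi n (Prod.fst (α := Vertex n) (β := Vertex n) v))
        (fun h hh => ?_)).trans (ih _)
      simp [Phi, hh n le_rfl]
    · refine (PhiInv_congr n (c' := Phi n (Prod.snd (α := Vertex n) (β := Vertex n) v))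
        (fun h hh => ?_)).trans (ih _)
      have h1 : (h + gen n) n = 1 := by simp [gen, hh n le_rfl]
      have h2 : gen n + (h + gen n) = h := by
        rw [add_comm h, ← add_assoc, add_self, zero_add]
      simp [Phi, h2, h1]

theorem Phi_PhiInv (n : ℕ) (c : Config) (h : D) (hh : ∀ i, n ≤ i → h i = 0) :
    Phi n (PhiInv n c) h = c h := by
  induction n generalizing c h with
  | zero =>
    have : h = 0 := by
      ext i
      simp [hh i (by omega)]
    rw [this]
    rfl
  | succ n ih =>
    simp only [Phi, PhiInv]
    split_ifs with h0
    · refine ih c h (fun i hi => ?_)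
      rcases hi.eq_or_lt with rfl | hi
      · exact h0
      · exact hh i hi
    · rw [ih]
      · rw [add_comm (gen n), add_assoc, add_self, add_zero]
      · intro i hi
        rcases hi.eq_or_lt with rfl | hi
        · have : h n = 1 := by
            generalize h n = a at h0
            revert a
            decide
          simp [gen, this, zmod_add_self]
        · have : n ≠ i := by omega
          simp [gen, this, hh i hi]

theorem source_PhiInv (n : ℕ) (c : Config) (β : ZMod 2) :
    source (PhiInv (n + 1) c) β = PhiInv n (fun h => c (h + Finsupp.single n β)) := by
  by_cases h0 : β = 0
  · simp [source, PhiInv, h0]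
  · have h1 : β = 1 := by
      revert β
      decide
    simp [source, PhiInv, h1, gen]

/-- The path with a given image under `Ψ`. -/
def psiInv (p : Config × BinSeq) : PathSpace where
  vertex n := PhiInv n (fun h => p.1 (h + partialSum p.2 n))
  index := p.2
  source_eq n := by
    rw [source_PhiInv]
    refine congrArg (PhiInv n) (funext fun h => congrArg p.1 ?_)
    rw [partialSum, Finset.sum_range_succ, ← partialSum, add_assoc,
      add_comm (partialSum p.2 n), ← add_assoc (Finsupp.single n (p.2 n)), add_self, zero_add]

/-- The map `Ψ` is a bijection of the path space onto `{0, 1}^𝒟 × {0, 1}^ℕ`. -/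
def psiEquiv : PathSpace ≃ Config × BinSeq where
  toFun := psi
  invFun := psiInv
  left_inv x := by
    refine PathSpace.ext (funext fun n => ?_) rfl
    refine (PhiInv_congr n (c' := Phi n (x.vertex n)) (fun h hh => ?_)).trans (PhiInv_Phi n _)
    change F x (h + partialSum x.index n) = _
    have hl : len (h + partialSum x.index n) ≤ n := by
      refine Finset.sup_le (fun i hi => ?_)
      by_contra hlt
      refine Finsupp.mem_support_iff.1 hi ?_
      rw [Finsupp.add_apply, hh i (by omega), partialSum_apply_of_le _ (by omega), zero_add]
    rw [F_eq x _ n hl, add_assoc, add_self, add_zero]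
  right_inv p := by
    refine Prod.ext (funext fun g => ?_) rfl
    change Phi (len g) (PhiInv (len g) (fun h => p.1 (h + partialSum p.2 (len g))))
      (g + partialSum p.2 (len g)) = p.1 g
    rw [Phi_PhiInv]
    · rw [add_assoc, add_self, add_zero]
    · intro i hi
      rw [Finsupp.add_apply, apply_eq_zero_of_len_le hi, partialSum_apply_of_le _ hi, zero_add]

/-- The measure `μ^σ` on the path space: the pushforward of `ω^σ` under `Ψ⁻¹` (a measurable map by
`measurable_psiEquiv_symm` below). -/
def muSigma (σ : ℕ → Fin 2) : Measure PathSpace := (omegaSigma σ).map psiEquiv.symm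

theorem finite_vertex (n : ℕ) : Finite (Vertex n) := by
  induction n with
  | zero => exact inferInstanceAs (Finite (ZMod 2))
  | succ n ih => exact inferInstanceAs (Finite (Vertex n × Vertex n))

theorem measurable_psiEquiv_symm : Measurable psiEquiv.symm := by
  have hP : ∀ n (f : D → Config × BinSeq → ZMod 2), (∀ h, Measurable (f h)) →
      Measurable (fun p => PhiInv n (fun h => f h p)) := by
    intro n
    induction n with
    | zero => exact fun f hf => hf 0
    | succ n ih =>
      intro f hf
      have hm : Measurable (fun p => (PhiInv n (fun h => f h p),
          PhiInv n (fun h => f (h + gen n) p))) :=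
        (ih f hf).prodMk (ih (fun h => f (h + gen n)) (fun h => hf _))
      have hfin : Finite (Vertex n) := finite_vertex n
      intro s _
      exact hm (Set.Finite.measurableSet (α := Vertex n × Vertex n) (Set.toFinite _))
  refine measurable_comap_iff.2 (Measurable.prodMk (measurable_pi_lambda _ fun n => ?_)
    measurable_snd)
  refine hP n (fun h p => p.1 (h + partialSum p.2 n)) (fun h => ?_)
  have h1 : Measurable (fun q : Config × (Fin n → ZMod 2) =>
      q.1 (h + ∑ i : Fin n, Finsupp.single (i : ℕ) (q.2 i))) :=
    measurable_from_prod_countable_left fun b =>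
      measurable_pi_apply (h + ∑ i : Fin n, Finsupp.single (i : ℕ) (b i))
  have h2 : Measurable (fun p : Config × BinSeq => (p.1, fun i : Fin n => p.2 i)) :=
    measurable_fst.prodMk
      (measurable_pi_lambda _ fun i => (measurable_pi_apply (i : ℕ)).comp measurable_snd)
  have h3 := h1.comp h2
  have h4 : (fun p : Config × BinSeq => p.1 (h + partialSum p.2 n)) =
      (fun q : Config × (Fin n → ZMod 2) =>
        q.1 (h + ∑ i : Fin n, Finsupp.single (i : ℕ) (q.2 i))) ∘
      (fun p : Config × BinSeq => (p.1, fun i : Fin n => p.2 i)) := by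
    funext p
    simp only [Function.comp, partialSum, Finset.sum_range]
  rw [h4]
  exact h3

end OrderedPairs

end

/-! Under `omegaSigma σ` almost every configuration is constant on the classes modulo `𝒟^σ`, and its
values on distinct classes are independent fair bits. Hence the shifts of a point by the elements of
`𝒟_n` involve, near the origin, only the bits at the classes met by `𝒟_n`. These are represented by
`reps σ n`, and by `card_reps` their number is exactly `h_n`. The sequence component is merely
translated, so it contributes a bounded number of bits. The entropy of the averaged metric is
therefore comparable to `h_n`.

Upper bound (`exists_epsEntropy_le`). By `IsSummableAdmissibleMetric.exists_local_bound`, points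
agreeing on a finite window of size `m` are `ρ`-close up to an error function `φ` of small integral.
After averaging, Markov's inequality confines the points with large error to a small set. Off that
set, the `h_n` bits and `m` coordinates of the sequence determine a point up to averaged distance
less than `ε`.

Lower bound (`exists_le_epsEntropy`). By `IsSummableAdmissibleMetric.exists_separation`,
configurations with different values at `0` are at distance at least `δ`, apart from a small bad
set. On averaging, a small averaged distance forces a small normalized Hamming distance between the
`h_n` bits. Hamming balls of radius `h_n / 16` have exponentially small measure in `h_n`, so
exponentially many pieces are needed.

The path space is handled by transfer: `Ψ` is a measurable isomorphism that intertwines the two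
actions and carries `μ^σ` to `ω^σ`. -/

/-! ### Admissible metrics: dense sequences, separation of sets, existence -/

section Metrics

/-- A separable semimetric is separable on subsets. -/
theorem SeparableOn.mono {X : Type*} {ρ : X → X → ℝ} (hρ : IsSemimetric ρ) {A B : Set X}
    (hB : SeparableOn ρ B) (hAB : A ⊆ B) : SeparableOn ρ A := by
  classical
  obtain ⟨S, hS, -, hd⟩ := hB
  -- `S` need not meet `A`. For each `s ∈ S` and each `n`, a point of `A` within `1 / (n + 1)` of
  -- `s` is chosen whenever there is one.
  let P : X × ℕ → Prop := fun q => ∃ a ∈ A, ρ a q.1 < 1 / ((q.2 : ℝ) + 1)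
  let f : X × ℕ → X := fun q => if h : P q then h.choose else q.1
  refine ⟨f '' ((S ×ˢ Set.univ) ∩ {q | P q}), ((hS.prod Set.countable_univ).mono
    Set.inter_subset_left).image f, ?_, ?_⟩
  · rintro _ ⟨q, ⟨-, hq⟩, rfl⟩
    have hq' : P q := hq
    simp only [f, dif_pos hq']
    exact hq'.choose_spec.1
  · intro x hx δ hδ
    obtain ⟨n, hn⟩ := exists_nat_one_div_lt (half_pos hδ)
    obtain ⟨s, hs, hxs⟩ := hd x (hAB hx) (1 / ((n : ℝ) + 1)) (by positivity)
    have hq : P (s, n) := ⟨x, hx, hxs⟩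
    refine ⟨f (s, n), ⟨(s, n), ⟨⟨hs, trivial⟩, hq⟩, rfl⟩, ?_⟩
    simp only [f, dif_pos hq]
    have h1 := hq.choose_spec.2
    have h2 := hρ.triangle x s hq.choose
    rw [hρ.symm s] at h2
    simp only at h1
    linarith

theorem IsSemimetric.abs_sub_le {X : Type*} {ρ : X → X → ℝ} (hρ : IsSemimetric ρ) (x y z : X) :
    |ρ x z - ρ y z| ≤ ρ x y := by
  have h1 := hρ.triangle x y z
  have h2 := hρ.triangle y x z
  rw [hρ.symm y x] at h2
  exact abs_le.2 ⟨by linarith, by linarith⟩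

variable {X : Type*} [MeasurableSpace X] {μ : Measure X} {ρ : X → X → ℝ}

/-- A summable admissible metric has a dense sequence of points, the distances to which are
integrable functions. -/
theorem IsSummableAdmissibleMetric.exists_dense_seq [IsProbabilityMeasure μ]
    (hρ : IsSummableAdmissibleMetric μ ρ) :
    ∃ (s : ℕ → X) (X₁ : Set X), μ X₁ᶜ = 0 ∧ (∀ j, Integrable (fun x => ρ x (s j)) μ) ∧
      (∀ x ∈ X₁, ∀ δ : ℝ, 0 < δ → ∃ j, ρ x (s j) < δ) ∧
      ∀ x ∈ X₁, ∀ y ∈ X₁, ρ x y = 0 → x = y := by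
  obtain ⟨X₀, h0, hsep, hmet⟩ := hρ.exists_full
  have hint := hρ.summable.prod_left_ae
  have hfull : μ (X₀ ∩ {y | Integrable (fun x => ρ x y) μ})ᶜ = 0 := by
    rw [Set.compl_inter]
    exact measure_union_null h0 hint
  have hne : (X₀ ∩ {y | Integrable (fun x => ρ x y) μ}).Nonempty := by
    rw [Set.nonempty_iff_ne_empty]
    intro h
    rw [h, Set.compl_empty, measure_univ] at hfull
    exact one_ne_zero hfull
  -- By Fubini almost every section of `ρ` is integrable; passing to a subset lets the dense points
  -- be taken among the points with integrable sections.
  obtain ⟨S, hS, hSX, hd⟩ := hsep.mono hρ.semimetric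
    (Set.inter_subset_left (t := {y | Integrable (fun x => ρ x y) μ}))
  have hSne : S.Nonempty := by
    obtain ⟨x, hx⟩ := hne
    obtain ⟨s, hs, -⟩ := hd x hx 1 one_pos
    exact ⟨s, hs⟩
  obtain ⟨s, rfl⟩ := hS.exists_eq_range hSne
  refine ⟨s, _, hfull, fun j => (hSX ⟨j, rfl⟩).2, fun x hx δ hδ => ?_,
    fun x hx y hy => hmet x hx.1 y hy.1⟩
  obtain ⟨_, ⟨j, rfl⟩, hj⟩ := hd x hx δ hδ
  exact ⟨j, hj⟩

/-- Disjoint compact sets of sequences are uniformly apart in finitely many coordinates. -/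
theorem exists_separation_of_isCompact {K L : Set (ℕ → ℝ)} (hK : IsCompact K) (hL : IsCompact L)
    (hd : Disjoint K L) :
    ∃ δ : ℝ, 0 < δ ∧ ∀ u ∈ K, ∀ v ∈ L, ∃ j, δ < |u j - v j| := by
  -- The sets `U n` form an increasing open cover of the compact set `K ×ˢ L`, so a single one
  -- contains it.
  let U : ℕ → Set ((ℕ → ℝ) × (ℕ → ℝ)) := fun n =>
    ⋃ j, {p | 1 / ((n : ℝ) + 1) < |p.1 j - p.2 j|}
  have hU : ∀ n, IsOpen (U n) := fun n =>
    isOpen_iUnion fun j => isOpen_lt continuous_const (by fun_prop)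
  have hmono : Monotone U := by
    refine fun m n hmn => Set.iUnion_mono fun j p hp => ?_
    have hmn' : (m : ℝ) ≤ n := Nat.cast_le.2 hmn
    have h : 1 / ((n : ℝ) + 1) ≤ 1 / ((m : ℝ) + 1) :=
      one_div_le_one_div_of_le (by positivity) (by linarith)
    exact h.trans_lt hp
  have hcov : K ×ˢ L ⊆ ⋃ n, U n := by
    rintro ⟨u, v⟩ ⟨hu, hv⟩
    have huv : u ≠ v := fun h => Set.disjoint_left.1 hd hu (h ▸ hv)
    obtain ⟨j, hj⟩ := Function.ne_iff.1 huv
    obtain ⟨n, hn⟩ := exists_nat_one_div_lt (abs_pos.2 (sub_ne_zero.2 hj))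
    exact Set.mem_iUnion.2 ⟨n, Set.mem_iUnion.2 ⟨j, hn⟩⟩
  obtain ⟨n, hn⟩ := (hK.prod hL).elim_directed_cover U hU hcov hmono.directed_le
  refine ⟨1 / ((n : ℝ) + 1), by positivity, fun u hu v hv => ?_⟩
  exact Set.mem_iUnion.1 (hn (Set.mk_mem_prod hu hv))

/-- With respect to a summable admissible metric, a measurable set and its complement are at a
positive distance after removing a set of small measure. -/
theorem IsSummableAdmissibleMetric.exists_separation [StandardBorelSpace X]
    [IsProbabilityMeasure μ] (hρ : IsSummableAdmissibleMetric μ ρ) {E : Set X}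
    (hE : MeasurableSet E) {γ : ℝ} (hγ : 0 < γ) :
    ∃ δ : ℝ, 0 < δ ∧ ∃ B : Set X, MeasurableSet B ∧ μ.real B < γ ∧
      ∀ x y, x ∉ B → y ∉ B → x ∈ E → y ∉ E → δ ≤ ρ x y := by
  obtain ⟨s, X₁, hX₁, hint, hdense, hmet⟩ := hρ.exists_dense_seq
  -- The distances to a dense sequence embed `X`, off a null set `Z`, into `ℕ → ℝ`. Each distance is
  -- only a.e. measurable, hence the measurable representatives.
  let f : ℕ → X → ℝ := fun j => (hint j).aestronglyMeasurable.aemeasurable.mk _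
  have hf : ∀ j, Measurable (f j) := fun j => AEMeasurable.measurable_mk _
  have hfe : ∀ᵐ x ∂μ, ∀ j, ρ x (s j) = f j x :=
    ae_all_iff.2 fun j => AEMeasurable.ae_eq_mk _
  let T : X → ℕ → ℝ := fun x j => f j x
  have hT : Measurable T := measurable_pi_lambda _ hf
  have hnull : μ (X₁ᶜ ∪ {x | ∀ j, ρ x (s j) = f j x}ᶜ) = 0 := measure_union_null hX₁ hfe
  obtain ⟨Z, hZ, hZm, hZ0⟩ := exists_measurable_superset_of_null hnull
  have hZ1 : ∀ x, x ∉ Z → x ∈ X₁ ∧ ∀ j, ρ x (s j) = f j x := by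
    intro x hx
    by_contra h
    exact hx (hZ (not_and_or.1 h))
  have hTinj : Set.InjOn T Zᶜ := by
    intro x hx y hy hxy
    refine hmet x (hZ1 x hx).1 y (hZ1 y hy).1 (le_antisymm ?_ (hρ.semimetric.nonneg x y))
    refine le_of_forall_pos_le_add fun η hη => ?_
    obtain ⟨j, hj⟩ := hdense x (hZ1 x hx).1 (η / 2) (half_pos hη)
    have h1 : ρ y (s j) = ρ x (s j) := by
      rw [(hZ1 x hx).2, (hZ1 y hy).2]
      exact (congrFun hxy j).symm
    have h2 := hρ.semimetric.triangle x (s j) y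
    rw [hρ.semimetric.symm (s j) y] at h2
    linarith
  -- By the Lusin–Souslin theorem the injective images of the two parts are Borel, so inner
  -- regularity gives compact sets that exhaust them up to `γ / 3` each.
  have hC : MeasurableSet (T '' (Zᶜ ∩ E)) :=
    (hZm.compl.inter hE).image_of_measurable_injOn hT (hTinj.mono Set.inter_subset_left)
  have hC' : MeasurableSet (T '' (Zᶜ ∩ Eᶜ)) :=
    (hZm.compl.inter hE.compl).image_of_measurable_injOn hT (hTinj.mono Set.inter_subset_left)
  have hη : ENNReal.ofReal (γ / 3) ≠ 0 := by simpa using (by positivity : 0 < γ / 3)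
  obtain ⟨K, hKC, hK, hKm⟩ := hC.exists_isCompact_sdiff_lt (measure_ne_top (μ.map T) _) hη
  obtain ⟨L, hLC, hL, hLm⟩ := hC'.exists_isCompact_sdiff_lt (measure_ne_top (μ.map T) _) hη
  have hdis : Disjoint (T '' (Zᶜ ∩ E)) (T '' (Zᶜ ∩ Eᶜ)) := by
    rw [Set.disjoint_left]
    rintro _ ⟨x, hx, rfl⟩ ⟨y, hy, hxy⟩
    exact hy.2 (hTinj hy.1 hx.1 hxy ▸ hx.2)
  obtain ⟨δ, hδ, hsepa⟩ := exists_separation_of_isCompact hK hL (hdis.mono hKC hLC)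
  rw [Measure.map_apply hT (hC.diff hK.measurableSet)] at hKm
  rw [Measure.map_apply hT (hC'.diff hL.measurableSet)] at hLm
  refine ⟨δ, hδ, Z ∪ (T ⁻¹' (T '' (Zᶜ ∩ E) \ K) ∪ T ⁻¹' (T '' (Zᶜ ∩ Eᶜ) \ L)),
    hZm.union ((hT (hC.diff hK.measurableSet)).union (hT (hC'.diff hL.measurableSet))), ?_, ?_⟩
  · have h1 : μ.real Z = 0 := by simp [measureReal_def, hZ0]
    have h2 : μ.real (T ⁻¹' (T '' (Zᶜ ∩ E) \ K)) ≤ γ / 3 :=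
      ENNReal.toReal_le_of_le_ofReal (by positivity) hKm.le
    have h3 : μ.real (T ⁻¹' (T '' (Zᶜ ∩ Eᶜ) \ L)) ≤ γ / 3 :=
      ENNReal.toReal_le_of_le_ofReal (by positivity) hLm.le
    have h4 := measureReal_union_le (μ := μ) Z
      (T ⁻¹' (T '' (Zᶜ ∩ E) \ K) ∪ T ⁻¹' (T '' (Zᶜ ∩ Eᶜ) \ L))
    have h5 := measureReal_union_le (μ := μ) (T ⁻¹' (T '' (Zᶜ ∩ E) \ K))
      (T ⁻¹' (T '' (Zᶜ ∩ Eᶜ) \ L))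
    linarith
  · intro x y hx hy hxE hyE
    simp only [Set.mem_union, not_or] at hx hy
    have hxK : T x ∈ K := by
      by_contra h
      exact hx.2.1 ⟨⟨x, ⟨hx.1, hxE⟩, rfl⟩, h⟩
    have hyL : T y ∈ L := by
      by_contra h
      exact hy.2.2 ⟨⟨y, ⟨hy.1, hyE⟩, rfl⟩, h⟩
    -- A gap in the `j`-th coordinate is a gap between the distances to `s j`, which bounds `ρ x y`
    -- from below.
    obtain ⟨j, hj⟩ := hsepa _ hxK _ hyL
    have h1 := hρ.semimetric.abs_sub_le x y (s j)
    rw [(hZ1 x hx.1).2, (hZ1 y hy.1).2] at h1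
    exact hj.le.trans h1

/-- A standard Borel probability space has a summable admissible metric. -/
theorem exists_isSummableAdmissibleMetric [StandardBorelSpace X] (μ : Measure X)
    [IsProbabilityMeasure μ] : ∃ ρ : X → X → ℝ, IsSummableAdmissibleMetric μ ρ := by
  obtain ⟨f, hf⟩ := exists_measurableEmbedding_real X
  -- The arctangent makes the metric pulled back from the line bounded, hence summable.
  let g : X → ℝ := fun x => Real.arctan (f x)
  have hg : Measurable g := Real.measurable_arctan.comp hf.measurable
  have hgi : Function.Injective g := Real.arctan_injective.comp hf.injective
  have hm : Measurable (fun p : X × X => |g p.1 - g p.2|) :=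
    ((hg.comp measurable_fst).sub (hg.comp measurable_snd)).abs
  refine ⟨fun x y => |g x - g y|, ⟨⟨⟨fun x y => abs_nonneg _, fun x => by simp,
    fun x y => abs_sub_comm _ _, fun x y z => abs_sub_le _ _ _⟩, hm.aemeasurable,
    ⟨Set.univ, by simp, ?_, fun x _ y _ h => hgi (sub_eq_zero.1 (abs_eq_zero.1 h))⟩⟩, ?_⟩⟩
  · let _ : PseudoMetricSpace X := PseudoMetricSpace.induced g inferInstance
    have : SecondCountableTopology X := TopologicalSpace.secondCountableTopology_induced X ℝ g
    obtain ⟨S, hS, hd⟩ := TopologicalSpace.exists_countable_dense X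
    refine ⟨S, hS, Set.subset_univ _, fun x _ δ hδ => ?_⟩
    obtain ⟨s, hs, h⟩ := Metric.dense_iff.1 hd x δ hδ
    refine ⟨s, h, ?_⟩
    have h' : dist s x < δ := hs
    rw [dist_comm] at h'
    exact h'
  · refine Integrable.of_bound hm.aestronglyMeasurable (2 * Real.pi) (ae_of_all _ fun p => ?_)
    rw [Real.norm_eq_abs, abs_abs]
    have h1 := Real.arctan_lt_pi_div_two (f p.1)
    have h2 := Real.neg_pi_div_two_lt_arctan (f p.1)
    have h3 := Real.arctan_lt_pi_div_two (f p.2)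
    have h4 := Real.neg_pi_div_two_lt_arctan (f p.2)
    exact abs_le.2 ⟨by simp only [g]; linarith, by simp only [g]; linarith⟩

/-- A measurable map with finitely many values whose fibres, outside of a set of small measure,
have small diameter, yields a small partition. -/
theorem HasSmallPartition.of_map {C : Type*} [Fintype C] [MeasurableSpace C]
    [MeasurableSingletonClass C] {ε : ℝ} {c : X → C} (hc : Measurable c) {Z : Set X}
    (hZ : NullMeasurableSet Z μ) (hμ : μ Z < ENNReal.ofReal ε) {d : ℝ} (hd : d < ε)
    (h : ∀ x y, x ∉ Z → y ∉ Z → c x = c y → ρ x y ≤ d) :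
    HasSmallPartition μ ρ ε (Fintype.card C) := by
  let e := Fintype.equivFin C
  -- Empty fibres are admitted as pieces, so the count is the full cardinality of `C`.
  refine ⟨Fin.cons Z (fun i => Zᶜ ∩ c ⁻¹' {e.symm i}), fun j => ?_, ?_, ?_, by simpa using hμ,
    fun j hj => ⟨d, hd, ?_⟩⟩
  · refine Fin.cases ?_ (fun i => ?_) j
    · simpa using hZ
    · simpa using hZ.compl.inter (hc (measurableSet_singleton _)).nullMeasurableSet
  · intro i j
    refine Fin.cases (Fin.cases (fun h => (h rfl).elim) (fun j _ => ?_) j)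
      (fun i => Fin.cases (fun _ => ?_) (fun j hij => ?_) j) i
    · simp only [Fin.cons_zero, Fin.cons_succ]
      exact disjoint_compl_right.mono_right Set.inter_subset_left
    · simp only [Fin.cons_zero, Fin.cons_succ]
      exact disjoint_compl_left.mono_left Set.inter_subset_left
    · simp only [Fin.cons_succ]
      rw [Set.disjoint_left]
      rintro x ⟨-, hx⟩ ⟨-, hx'⟩
      refine hij (congrArg Fin.succ (e.symm.injective ?_))
      rw [← (show c x = e.symm i from hx), ← (show c x = e.symm j from hx')]
  · refine Set.eq_univ_of_forall fun x => Set.mem_iUnion.2 ?_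
    by_cases hx : x ∈ Z
    · exact ⟨0, by simpa using hx⟩
    · exact ⟨(e (c x)).succ, by simp [hx]⟩
  · obtain ⟨i, rfl⟩ := Fin.exists_succ_eq.2 hj
    simp only [Fin.cons_succ]
    rintro x ⟨hx, hx'⟩ y ⟨hy, hy'⟩
    exact h x y hx hy ((show c x = e.symm i from hx').trans (show c y = e.symm i from hy').symm)

end Metrics

/-! ### Approximating a metric by finitely many coordinates -/

section Approximation

variable {X : Type*} [MeasurableSpace X] {μ : Measure X} {ρ : X → X → ℝ}

/-- The excess of an integrable function over a large constant has small integral. -/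
theorem exists_integral_excess_lt {f : X → ℝ} (hf : Integrable f μ) {η : ℝ}
    (hη : 0 < η) : ∃ M : ℝ, 0 ≤ M ∧ ∫ x, max (f x - M) 0 ∂μ < η := by
  have h : Tendsto (fun n : ℕ => ∫ x, max (f x - n) 0 ∂μ) atTop (nhds (∫ _, (0 : ℝ) ∂μ)) := by
    refine tendsto_integral_of_dominated_convergence (fun x => |f x|) (fun n => ?_) hf.abs
      (fun n => ae_of_all _ fun x => ?_) (ae_of_all _ fun x => ?_)
    · exact ((hf.aestronglyMeasurable.sub aestronglyMeasurable_const).sup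
        aestronglyMeasurable_const)
    · rw [Real.norm_eq_abs, abs_of_nonneg (le_max_right _ _)]
      refine max_le ?_ (abs_nonneg _)
      have : (0 : ℝ) ≤ n := n.cast_nonneg
      linarith [le_abs_self (f x)]
    · refine tendsto_const_nhds.congr' ?_
      filter_upwards [eventually_ge_atTop ⌈f x⌉₊] with n hn
      have : f x ≤ n := (Nat.le_ceil _).trans (by exact_mod_cast hn)
      rw [max_eq_right (by linarith)]
  rw [integral_zero] at h
  obtain ⟨n, hn⟩ := (h.eventually (gt_mem_nhds hη)).exists
  exact ⟨n, n.cast_nonneg, hn⟩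

/-- If the classes of a refining sequence of equivalence relations approximate all measurable sets,
then equivalent points are close to each other with respect to a summable admissible metric, up to
an error with small integral. -/
theorem IsSummableAdmissibleMetric.exists_local_bound [IsProbabilityMeasure μ]
    (hρ : IsSummableAdmissibleMetric μ ρ) {R : ℕ → X → X → Prop}
    (hR : ∀ m n, m ≤ n → ∀ x y, R n x y → R m x y)
    (happ : ∀ V : Set X, MeasurableSet V → ∀ η : ℝ, 0 < η → ∃ m, ∃ U : Set X, MeasurableSet U ∧
      (∀ x y, R m x y → (x ∈ U ↔ y ∈ U)) ∧ μ (symmDiff V U) < ENNReal.ofReal η)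
    {δ : ℝ} (hδ : 0 < δ) :
    ∃ m, ∃ φ : X → ℝ, (∀ x, 0 ≤ φ x) ∧ Integrable φ μ ∧ ∫ x, φ x ∂μ < δ ∧
      ∀ x y, R m x y → ρ x y ≤ δ + φ x + φ y := by
  obtain ⟨s, X₁, hX₁, hint, hdense, -⟩ := hρ.exists_dense_seq
  obtain ⟨M, hM, hMi⟩ := exists_integral_excess_lt (hint 0) (half_pos hδ)
  -- The bad set `B` below has measure at most `2 * η`, and the error there is `2 * M`; this
  -- contribution must stay below `δ / 2`, the other half being left to the excess of `ρ x (s 0)`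
  -- over `M`.
  obtain ⟨η, hη, hηM⟩ : ∃ η : ℝ, 0 < η ∧ 2 * M * (2 * η) < δ / 2 := by
    refine ⟨δ / (8 * (M + 1)), by positivity, ?_⟩
    rw [show 2 * M * (2 * (δ / (8 * (M + 1)))) = δ / 2 * (M / (M + 1)) by field_simp; ring]
    exact mul_lt_of_lt_one_right (by positivity) ((div_lt_one (by positivity)).2 (by linarith))
  have hV : ∀ j, NullMeasurableSet {x | ρ x (s j) < δ / 2} μ := fun j =>
    nullMeasurableSet_lt (hint j).aestronglyMeasurable.aemeasurable aemeasurable_const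
  -- Balls of radius `δ / 2`, replaced by genuinely measurable sets equal to them almost everywhere,
  -- as `happ` requires.
  let V : ℕ → Set X := fun j => toMeasurable μ {x | ρ x (s j) < δ / 2}
  have hVm : ∀ j, MeasurableSet (V j) := fun j => measurableSet_toMeasurable _ _
  have hVe : ∀ᵐ x ∂μ, ∀ j, x ∈ V j ↔ ρ x (s j) < δ / 2 := by
    refine ae_all_iff.2 fun j => ?_
    filter_upwards [(hV j).toMeasurable_ae_eq] with x hx
    exact iff_of_eq hx
  obtain ⟨Z, hZ, hZm, hZ0⟩ := exists_measurable_superset_of_null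
    (measure_union_null hX₁ hVe)
  have hZ1 : ∀ x, x ∉ Z → x ∈ X₁ ∧ ∀ j, x ∈ V j ↔ ρ x (s j) < δ / 2 := by
    intro x hx
    by_contra h
    exact hx (hZ (not_and_or.1 h))
  obtain ⟨J, hJ⟩ : ∃ J : ℕ, μ (⋃ j ∈ Finset.range J, V j)ᶜ < ENNReal.ofReal η := by
    have hmono : Antitone (fun J : ℕ => (⋃ j ∈ Finset.range J, V j)ᶜ) := fun a b hab =>
      Set.compl_subset_compl.2 (Set.biUnion_subset_biUnion_left fun j hj =>
        Finset.mem_range.2 ((Finset.mem_range.1 hj).trans_le hab))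
    have ht := tendsto_measure_iInter_atTop (μ := μ) (s := fun J : ℕ =>
      (⋃ j ∈ Finset.range J, V j)ᶜ) (fun J => ((Finset.range J).measurableSet_biUnion
        fun j _ => hVm j).compl.nullMeasurableSet) hmono ⟨0, measure_ne_top _ _⟩
    have h0 : μ (⋂ J : ℕ, (⋃ j ∈ Finset.range J, V j)ᶜ) = 0 := by
      refine measure_mono_null (fun x hx => ?_) hZ0
      by_contra hxZ
      obtain ⟨j, hj⟩ := hdense x (hZ1 x hxZ).1 (δ / 2) (half_pos hδ)
      refine Set.mem_iInter.1 hx (j + 1) (Set.mem_biUnion (x := j) ?_ (((hZ1 x hxZ).2 j).2 hj))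
      simp
    rw [h0] at ht
    exact (ht.eventually (gt_mem_nhds (by simpa using hη))).exists
  choose mm U hUm hUR hUV using fun j => happ (V j) (hVm j) (η / (J + 1)) (by positivity)
  -- Off `B` a point lies in one of the first `J` balls, and membership in each of them is decided
  -- by the invariant set `U j`. Equivalent points off `B` thus share a ball and are at distance
  -- less than `δ`.
  let B : Set X := Z ∪ ((⋃ j ∈ Finset.range J, V j)ᶜ ∪
    ⋃ j ∈ Finset.range J, symmDiff (V j) (U j))
  have hBm : MeasurableSet B := by
    refine hZm.union ((((Finset.range J).measurableSet_biUnion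
        fun j _ => hVm j).compl).union ((Finset.range J).measurableSet_biUnion fun j _ => ?_))
    exact (hVm j).symmDiff (hUm j)
  have hB : μ.real B ≤ 2 * η := by
    have h1 := measureReal_union_le (μ := μ) Z ((⋃ j ∈ Finset.range J, V j)ᶜ ∪
      ⋃ j ∈ Finset.range J, symmDiff (V j) (U j))
    have h2 := measureReal_union_le (μ := μ) (⋃ j ∈ Finset.range J, V j)ᶜ
      (⋃ j ∈ Finset.range J, symmDiff (V j) (U j))
    have h3 := measureReal_biUnion_finset_le (μ := μ) (Finset.range J)
      (fun j => symmDiff (V j) (U j))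
    have h4 : ∑ j ∈ Finset.range J, μ.real (symmDiff (V j) (U j)) ≤
        ∑ _j ∈ Finset.range J, η / (J + 1) :=
      Finset.sum_le_sum fun j _ => ENNReal.toReal_le_of_le_ofReal (by positivity) (hUV j).le
    have h5 : ∑ _j ∈ Finset.range J, η / ((J : ℝ) + 1) ≤ η := by
      rw [Finset.sum_const, Finset.card_range, nsmul_eq_mul, mul_div_assoc', div_le_iff₀
        (by positivity)]
      nlinarith
    have h6 : μ.real (⋃ j ∈ Finset.range J, V j)ᶜ ≤ η :=
      ENNReal.toReal_le_of_le_ofReal hη.le hJ.le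
    have h7 : μ.real Z = 0 := by simp [measureReal_def, hZ0]
    change μ.real (Z ∪ _) ≤ _
    linarith
  let f : X → ℝ := fun x => ρ x (s 0)
  -- If one of the points is in `B`, the path through `s 0` gives `ρ x y ≤ f x + f y`, which is at
  -- most `2 * M` plus the two excesses.
  let φ : X → ℝ := fun x => B.indicator (fun _ => 2 * M) x + max (f x - M) 0
  have hi1 : Integrable (B.indicator (fun _ => 2 * M)) μ :=
    (integrable_const (2 * M)).indicator hBm
  have hi2 : Integrable (fun x => max (f x - M) 0) μ :=
    ((hint 0).sub (integrable_const M)).pos_part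
  have hφ0 : ∀ x, 0 ≤ φ x := fun x =>
    add_nonneg (Set.indicator_nonneg (fun _ _ => by positivity) x) (le_max_right _ _)
  refine ⟨(Finset.range J).sup mm, φ, hφ0, hi1.add hi2, ?_, fun x y hxy => ?_⟩
  · rw [integral_add hi1 hi2, integral_indicator_const _ hBm, smul_eq_mul]
    have h1 : μ.real B * (2 * M) ≤ 2 * η * (2 * M) := by gcongr
    have h2 : ∫ x, max (f x - M) 0 ∂μ < δ / 2 := hMi
    linarith
  · have htri : ρ x y ≤ f x + f y := by
      have := hρ.semimetric.triangle x (s 0) y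
      rwa [hρ.semimetric.symm (s 0) y] at this
    have hmx := le_max_left (f x - M) 0
    have hmy := le_max_left (f y - M) 0
    have hmx0 := le_max_right (f x - M) 0
    have hmy0 := le_max_right (f y - M) 0
    by_cases hx : x ∈ B
    · have h1 : φ x = 2 * M + max (f x - M) 0 := by simp [φ, hx]
      have h2 : max (f y - M) 0 ≤ φ y :=
        le_add_of_nonneg_left (Set.indicator_nonneg (fun _ _ => by positivity) y)
      linarith
    by_cases hy : y ∈ B
    · have h1 : φ y = 2 * M + max (f y - M) 0 := by simp [φ, hy]
      have h2 : max (f x - M) 0 ≤ φ x :=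
        le_add_of_nonneg_left (Set.indicator_nonneg (fun _ _ => by positivity) x)
      linarith
    have hsymm : ∀ z, z ∉ B → z ∉ Z ∧ (∃ j ∈ Finset.range J, z ∈ V j) ∧
        ∀ j ∈ Finset.range J, z ∈ V j ↔ z ∈ U j := by
      intro z hz
      simp only [B, Set.mem_union, not_or, Set.mem_compl_iff, Set.mem_iUnion₂,
        exists_prop, not_exists, not_and] at hz
      refine ⟨hz.1, by simpa using hz.2.1, fun j hj => ?_⟩
      have := hz.2.2 j hj
      rw [Set.mem_symmDiff] at this
      tauto
    obtain ⟨hxZ, ⟨j, hj, hxV⟩, hxU⟩ := hsymm x hx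
    obtain ⟨hyZ, -, hyU⟩ := hsymm y hy
    have hR' := hR _ _ (Finset.le_sup (f := mm) hj) x y hxy
    have hyV : y ∈ V j := (hyU j hj).2 ((hUR j x y hR').1 ((hxU j hj).1 hxV))
    have h1 := ((hZ1 x hxZ).2 j).1 hxV
    have h2 := ((hZ1 y hyZ).2 j).1 hyV
    have h3 := hρ.semimetric.triangle x (s j) y
    rw [hρ.semimetric.symm (s j) y] at h3
    linarith [hφ0 x, hφ0 y]

end Approximation

/-! ### Entropy estimates, Markov's inequality and Hamming balls -/

section Entropy

theorem epsEntropy_le {X : Type*} [MeasurableSpace X] {μ : Measure X} {ρ : X → X → ℝ} {ε : ℝ}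
    {k : ℕ} (hk : 0 < k) (h : HasSmallPartition μ ρ ε k) :
    epsEntropy μ ρ ε ≤ ENNReal.ofReal (Real.logb 2 k) :=
  iInf₂_le k ⟨hk, h⟩

theorem le_epsEntropy {X : Type*} [MeasurableSpace X] {μ : Measure X} {ρ : X → X → ℝ} {ε c : ℝ}
    (h : ∀ k : ℕ, 0 < k → HasSmallPartition μ ρ ε k → c ≤ Real.logb 2 k) :
    ENNReal.ofReal c ≤ epsEntropy μ ρ ε :=
  le_iInf₂ fun k hk => ENNReal.ofReal_le_ofReal (h k hk.1 hk.2)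

theorem AsympEquiv.of_bounds {a : ℕ → ENNReal} {h : ℕ → ℝ} (hh : ∀ n, 0 < h n) {c C : ℝ}
    (hc : 0 < c) (h₁ : ∀ᶠ n in atTop, ENNReal.ofReal (c * h n) ≤ a n)
    (h₂ : ∀ᶠ n in atTop, a n ≤ ENNReal.ofReal (C * h n)) : AsympEquiv a h := by
  have h0 : ∀ n, ENNReal.ofReal (h n) ≠ 0 := fun n => by simpa using hh n
  refine ⟨lt_of_lt_of_le (ENNReal.ofReal_pos.2 hc) (le_liminf_of_le (by isBoundedDefault) ?_),
    lt_of_le_of_lt (limsup_le_of_le (by isBoundedDefault) ?_) (ENNReal.ofReal_lt_top (r := C))⟩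
  · filter_upwards [h₁] with n hn
    rwa [ENNReal.le_div_iff_mul_le (Or.inl (h0 n)) (Or.inl ENNReal.ofReal_ne_top),
      ← ENNReal.ofReal_mul hc.le]
  · filter_upwards [h₂] with n hn
    rwa [ENNReal.div_le_iff_le_mul (Or.inl (h0 n)) (Or.inl ENNReal.ofReal_ne_top),
      ← ENNReal.ofReal_mul' (hh n).le]

/-- Markov's inequality for the averages of a function over the shifts by the elements of a finite
set. -/
theorem markov_average {G X : Type*} [AddGroup G] [AddAction G X] [MeasurableSpace X]
    {μ : Measure X} (hμ : ∀ g : G, MeasurePreserving (fun x : X => g +ᵥ x) μ μ) {S : Finset G}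
    (hS : S.Nonempty) {φ : X → ℝ} (hφ : Integrable φ μ) (h0 : ∀ x, 0 ≤ φ x) {θ : ℝ}
    (hθ : 0 < θ) :
    NullMeasurableSet {x | θ ≤ (S.card : ℝ)⁻¹ * ∑ g ∈ S, φ (g +ᵥ x)} μ ∧
      μ.real {x | θ ≤ (S.card : ℝ)⁻¹ * ∑ g ∈ S, φ (g +ᵥ x)} ≤ (∫ x, φ x ∂μ) / θ := by
  have hi : ∀ g : G, Integrable (fun x => φ (g +ᵥ x)) μ := fun g =>
    (hμ g).integrable_comp_of_integrable hφ
  have hi' : Integrable (fun x => (S.card : ℝ)⁻¹ * ∑ g ∈ S, φ (g +ᵥ x)) μ :=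
    (integrable_finsetSum _ fun g _ => hi g).const_mul _
  refine ⟨nullMeasurableSet_le aemeasurable_const hi'.aestronglyMeasurable.aemeasurable, ?_⟩
  have hm := mul_meas_ge_le_integral_of_nonneg (μ := μ) (ae_of_all _ fun x =>
    mul_nonneg (inv_nonneg.2 (Nat.cast_nonneg S.card)) (Finset.sum_nonneg fun g _ => h0 (g +ᵥ x)))
    hi' θ
  -- Invariance of `μ` gives all shifts of `φ` the same integral, so averaging does not change the
  -- integral.
  have he : ∀ g : G, ∫ x, φ (g +ᵥ x) ∂μ = ∫ x, φ x ∂μ := fun g => by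
    have h1 := (hμ g).map_eq
    have h2 : AEStronglyMeasurable φ (μ.map fun x => g +ᵥ x) := h1.symm ▸ hφ.aestronglyMeasurable
    rw [← integral_map (hμ g).aemeasurable h2, h1]
  rw [integral_const_mul, integral_finsetSum _ fun g _ => hi g,
    Finset.sum_congr rfl fun g _ => he g,
    Finset.sum_const, nsmul_eq_mul, inv_mul_cancel_left₀
      (Nat.cast_ne_zero.2 (Finset.card_pos.2 hS).ne')] at hm
  rw [le_div_iff₀ hθ, mul_comm]
  exact hm

/-- A bound for the number of points of a ball of small radius in the discrete cube. -/
theorem card_hamming_ball_le {ι : Type*} [Fintype ι] [DecidableEq ι] (v : ι → ZMod 2) :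
    ((Finset.univ.filter fun u : ι → ZMod 2 =>
      16 * (Finset.univ.filter fun i => u i ≠ v i).card ≤ Fintype.card ι).card : ℝ) ≤
      (13 / 10) ^ Fintype.card ι := by
  set N := Fintype.card ι
  set A := Finset.univ.filter fun u : ι → ZMod 2 =>
    16 * (Finset.univ.filter fun i => u i ≠ v i).card ≤ N
  -- Exponential moment method: a point at Hamming distance `d` from `v` has weight `8⁻ᵈ`, so the
  -- total weight is `(1 + 1/8) ^ N`.
  let w : (ι → ZMod 2) → ℝ := fun u => ∏ i, if u i ≠ v i then 1 / 8 else 1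
  have hw0 : ∀ u, 0 ≤ w u := fun u => Finset.prod_nonneg fun i _ => by split_ifs <;> norm_num
  have hsum : ∑ u, w u = (9 / 8) ^ N := by
    have h1 := Finset.prod_univ_sum (fun _ : ι => (Finset.univ : Finset (ZMod 2)))
      (fun i a => if a ≠ v i then (1 / 8 : ℝ) else 1)
    rw [Fintype.piFinset_univ] at h1
    have h2 : ∀ b : ZMod 2, ∑ a : ZMod 2, (if a ≠ b then (1 / 8 : ℝ) else 1) = 9 / 8 := by
      intro b
      rw [show (Finset.univ : Finset (ZMod 2)) = {b, b + 1} by revert b; decide,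
        Finset.sum_pair (by revert b; decide), if_neg (by simp), if_pos (by simp)]
      norm_num
    change ∑ u : ι → ZMod 2, ∏ i, _ = _
    rw [← h1, Finset.prod_congr rfl fun i _ => h2 (v i), Finset.prod_const, Finset.card_univ]
  -- The constants fit because `0.87 ^ 16 ≤ 1/8` and `9/8 ≤ 1.3 * 0.87`. What matters later is that
  -- `13/10 < 2`.
  have hw : ∀ u ∈ A, (87 / 100 : ℝ) ^ N ≤ w u := by
    intro u hu
    have hu' : 16 * (Finset.univ.filter fun i => u i ≠ v i).card ≤ N := (Finset.mem_filter.1 hu).2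
    have h1 : w u = (1 / 8) ^ (Finset.univ.filter fun i => u i ≠ v i).card := by
      simp only [w]
      rw [Finset.prod_ite, Finset.prod_const_one, mul_one, Finset.prod_const]
    rw [h1]
    calc (87 / 100 : ℝ) ^ N ≤ (87 / 100) ^ (16 * (Finset.univ.filter fun i => u i ≠ v i).card) :=
          pow_le_pow_of_le_one (by norm_num) (by norm_num) hu'
      _ = ((87 / 100) ^ 16) ^ (Finset.univ.filter fun i => u i ≠ v i).card := pow_mul _ _ _
      _ ≤ _ := pow_le_pow_left₀ (by norm_num) (by norm_num) _
  have h1 : (A.card : ℝ) * (87 / 100) ^ N ≤ (9 / 8) ^ N := by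
    rw [← hsum, ← nsmul_eq_mul, ← Finset.sum_const]
    exact (Finset.sum_le_sum hw).trans
      (Finset.sum_le_sum_of_subset_of_nonneg (Finset.subset_univ _) fun u _ _ => hw0 u)
  have h2 : (9 / 8 : ℝ) ^ N ≤ (13 / 10) ^ N * (87 / 100) ^ N := by
    rw [← mul_pow]
    exact pow_le_pow_left₀ (by norm_num) (by norm_num) _
  exact le_of_mul_le_mul_right (h1.trans h2) (by positivity)

end Entropy

/-! ### Classes modulo `𝒟^σ`, their representatives, and the measures -/

namespace OrderedPairs

/-- A nonzero coefficient in `ZMod 2` equals one, so `g` is the sum of the generators in its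
support. This serves both `𝒟_n` and `𝒟^σ`. -/
theorem mem_closure_gen {P : ℕ → Prop} {g : D} (hg : ∀ i, ¬ P i → g i = 0) :
    g ∈ AddSubgroup.closure {g | ∃ i, P i ∧ g = gen i} := by
  rw [← Finsupp.sum_single g]
  refine AddSubgroup.sum_mem _ fun i hi => AddSubgroup.subset_closure ⟨i, ?_, ?_⟩
  · by_contra h
    exact Finsupp.mem_support_iff.1 hi (hg i h)
  · have h0 := Finsupp.mem_support_iff.1 hi
    have : g i = 1 := by
      generalize g i = a at h0
      revert a
      decide
    simp only [this, gen]

theorem mem_equipD {n : ℕ} {g : D} : g ∈ equipD n ↔ ∀ i, n ≤ i → g i = 0 := by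
  rw [equipD, Set.Finite.mem_toFinset]
  exact ⟨apply_eq_zero_of_mem_subD, fun h => mem_closure_gen fun i hi => h i (not_lt.1 hi)⟩

theorem equipD_nonempty (n : ℕ) : (equipD n).Nonempty := ⟨0, mem_equipD.2 fun _ _ => rfl⟩

/-- The projection of `𝒟` along `𝒟^σ`, which keeps the coordinates `i` with `σ_i = 1`. -/
noncomputable def trunc (σ : ℕ → Fin 2) : D →+ D := Finsupp.filterAddHom fun i => σ i ≠ 0

theorem trunc_apply (σ : ℕ → Fin 2) (g : D) (i : ℕ) :
    trunc σ g i = if σ i ≠ 0 then g i else 0 := by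
  exact Finsupp.filter_apply _ _ _

theorem trunc_trunc (σ : ℕ → Fin 2) (g : D) : trunc σ (trunc σ g) = trunc σ g := by
  ext i
  simp only [trunc_apply]
  split_ifs <;> rfl

theorem mem_subDSigma {σ : ℕ → Fin 2} {g : D} : g ∈ subDSigma σ ↔ trunc σ g = 0 := by
  constructor
  · intro hg
    refine (AddSubgroup.closure_le (K := (trunc σ).ker)).2 ?_ hg
    rintro _ ⟨i, hi, rfl⟩
    refine Finsupp.ext fun j => ?_
    rw [trunc_apply]
    split_ifs with hj
    · exact Finsupp.single_eq_of_ne fun h => hj (h ▸ hi)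
    · rfl
  · intro hg
    refine mem_closure_gen fun i hi => ?_
    have := DFunLike.congr_fun hg i
    rwa [trunc_apply, if_pos hi] at this

theorem mk_trunc (σ : ℕ → Fin 2) (g : D) :
    (QuotientAddGroup.mk (trunc σ g) : D ⧸ subDSigma σ) = QuotientAddGroup.mk g := by
  rw [QuotientAddGroup.eq, mem_subDSigma, map_add, map_neg, trunc_trunc, neg_add_cancel]

theorem trunc_eq_of_mk_eq {σ : ℕ → Fin 2} {g h : D}
    (hgh : (QuotientAddGroup.mk g : D ⧸ subDSigma σ) = QuotientAddGroup.mk h) :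
    trunc σ g = trunc σ h := by
  rw [QuotientAddGroup.eq, mem_subDSigma, map_add, map_neg, neg_add_eq_zero] at hgh
  exact hgh

/-- The representatives in `𝒟_n` of the classes modulo `𝒟^σ`. -/
noncomputable def reps (σ : ℕ → Fin 2) (n : ℕ) : Finset D :=
  ((Finset.range n).filter fun i => σ i ≠ 0).finsupp fun _ => Finset.univ

theorem mem_reps {σ : ℕ → Fin 2} {n : ℕ} {g : D} :
    g ∈ reps σ n ↔ g ∈ equipD n ∧ trunc σ g = g := by
  rw [reps, Finset.mem_finsupp_iff, mem_equipD]
  constructor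
  · rintro ⟨h, -⟩
    have h' : ∀ i, ¬ (i < n ∧ σ i ≠ 0) → g i = 0 := fun i hi => by
      by_contra hne
      exact hi (by simpa using h (Finsupp.mem_support_iff.2 hne))
    refine ⟨fun i hi => h' i fun h => by omega, Finsupp.ext fun i => ?_⟩
    rw [trunc_apply]
    split_ifs with hi
    · rfl
    · exact (h' i fun h => hi h.2).symm
  · rintro ⟨h1, h2⟩
    refine ⟨fun i hi => ?_, fun _ _ => Finset.mem_univ _⟩
    have hi := Finsupp.mem_support_iff.1 hi
    rw [Finset.mem_filter, Finset.mem_range]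
    refine ⟨not_le.1 fun h => hi (h1 i h), fun h => hi ?_⟩
    rw [← h2, trunc_apply, if_neg (not_not.2 h)]

/-- Every `i < n` with `σ_i = 1` is one free binary coordinate. This count is where the scaling
sequence comes from. -/
theorem card_reps (σ : ℕ → Fin 2) (n : ℕ) :
    (reps σ n).card = 2 ^ ∑ i ∈ Finset.range n, (σ i : ℕ) := by
  rw [reps, Finset.card_finsupp, Finset.prod_const, Finset.card_univ, ZMod.card,
    Finset.card_filter]
  congr 1
  refine Finset.sum_congr rfl fun i _ => ?_
  generalize σ i = a
  revert a
  decide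

theorem trunc_mem_reps {σ : ℕ → Fin 2} {n : ℕ} {g : D} (hg : g ∈ equipD n) :
    trunc σ g ∈ reps σ n := by
  refine mem_reps.2 ⟨mem_equipD.2 fun i hi => ?_, trunc_trunc σ g⟩
  rw [trunc_apply, mem_equipD.1 hg i hi, ite_self]

theorem add_mem_equipD {n : ℕ} {g h : D} (hg : g ∈ equipD n) (hh : h ∈ equipD n) :
    g + h ∈ equipD n :=
  mem_equipD.2 fun i hi => by
    rw [Finsupp.add_apply, mem_equipD.1 hg i hi, mem_equipD.1 hh i hi, add_zero]

/-- Averaging over `𝒟_n` a function of the class modulo `𝒟^σ` is averaging over the classes. -/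
theorem average_trunc (σ : ℕ → Fin 2) (n : ℕ) (f : D → ℝ) :
    ((equipD n).card : ℝ)⁻¹ * ∑ g ∈ equipD n, f (trunc σ g) =
      ((reps σ n).card : ℝ)⁻¹ * ∑ q ∈ reps σ n, f q := by
  set K := ((equipD n).filter fun g => trunc σ g = 0).card
  have hK : ∀ q ∈ reps σ n, ((equipD n).filter fun g => trunc σ g = q).card = K := by
    intro q hq
    obtain ⟨hq1, hq2⟩ := mem_reps.1 hq
    -- Translation by `q` is an involution exchanging the fibre over `q` with the fibre over `0`, so
    -- all fibres have the same size.
    refine Finset.card_bij' (fun g _ => g + q) (fun g _ => g + q) ?_ ?_ ?_ ?_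
    · intro g hg
      rw [Finset.mem_filter] at hg ⊢
      exact ⟨add_mem_equipD hg.1 hq1, by rw [map_add, hg.2, hq2, add_self]⟩
    · intro g hg
      rw [Finset.mem_filter] at hg ⊢
      exact ⟨add_mem_equipD hg.1 hq1, by rw [map_add, hg.2, hq2, zero_add]⟩
    all_goals exact fun g _ => by rw [add_assoc, add_self, add_zero]
  have hmaps : ∀ g ∈ equipD n, trunc σ g ∈ reps σ n := fun g hg => trunc_mem_reps hg
  have hsum : ∑ g ∈ equipD n, f (trunc σ g) = K * ∑ q ∈ reps σ n, f q := by
    rw [← Finset.sum_fiberwise_of_maps_to hmaps, Finset.mul_sum]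
    refine Finset.sum_congr rfl fun q hq => ?_
    rw [← hK q hq, ← nsmul_eq_mul, ← Finset.sum_const]
    exact Finset.sum_congr rfl fun g hg => by rw [(Finset.mem_filter.1 hg).2]
  have hcard : (equipD n).card = K * (reps σ n).card := by
    rw [Finset.card_eq_sum_card_fiberwise hmaps, Finset.sum_congr rfl hK, Finset.sum_const,
      smul_eq_mul, mul_comm]
  have hK0 : (K : ℝ) ≠ 0 := by
    intro h
    have := Finset.card_pos.2 (equipD_nonempty n)
    rw [hcard, Nat.cast_eq_zero.1 h, zero_mul] at this
    exact lt_irrefl _ this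
  rw [hsum, hcard, Nat.cast_mul, mul_inv]
  field_simp

/-! ### The measures -/

instance (ι : Type) : IsProbabilityMeasure (lebesgue ι) := by
  unfold lebesgue
  infer_instance

theorem measurable_precomp {ι κ : Type*} (f : κ → ι) :
    Measurable (fun (u : ι → ZMod 2) (i : κ) => u (f i)) :=
  measurable_pi_lambda _ fun i => measurable_pi_apply (f i)

instance (σ : ℕ → Fin 2) : IsProbabilityMeasure (mSigma σ) :=
  Measure.isProbabilityMeasure_map (measurable_precomp _).aemeasurable

instance (σ : ℕ → Fin 2) : IsProbabilityMeasure (omegaSigma σ) := by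
  unfold omegaSigma
  infer_instance

theorem coin_singleton (a : ZMod 2) : coin {a} = 2⁻¹ := by
  rw [coin, PMF.toMeasure_apply_singleton _ _ (measurableSet_singleton a),
    PMF.uniformOfFintype_apply, ZMod.card]
  rfl

theorem map_add_coin (a : ZMod 2) : coin.map (fun b => b + a) = coin := by
  refine Measure.ext_of_singleton fun b => ?_
  rw [Measure.map_apply (measurable_of_countable _) (measurableSet_singleton b),
    show (fun b => b + a) ⁻¹' {b} = {b - a} by ext c; exact eq_sub_iff_add_eq.symm, coin_singleton,
    coin_singleton]

theorem map_precomp_lebesgue {ι κ : Type} {f : κ → ι} (hf : Function.Injective f) :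
    (lebesgue ι).map (fun u i => u (f i)) = lebesgue κ :=
  Measure.map_infinitePi_infinitePi_of_inj hf

theorem measurePreserving_add_lebesgue {ι : Type} (a : ι → ZMod 2) :
    MeasurePreserving (fun u => u + a) (lebesgue ι) (lebesgue ι) := by
  refine ⟨measurable_pi_lambda _ fun i => (measurable_of_countable fun b : ZMod 2 => b + a i).comp
    (measurable_pi_apply i), ?_⟩
  refine (Measure.infinitePi_map_pi (fun _ : ι => coin) (f := fun i b => b + a i)
    fun i => measurable_of_countable _).trans ?_
  simp only [map_add_coin]
  rfl

/-- The shift by `g` descends to translation by the class of `g` on the quotient, an injective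
relabelling of independent identically distributed coordinates. -/
theorem measurePreserving_shift_mSigma (σ : ℕ → Fin 2) (g : D) :
    MeasurePreserving (fun (w : Config) (h : D) => w (h + g)) (mSigma σ) (mSigma σ) := by
  refine ⟨measurable_precomp _, ?_⟩
  rw [mSigma, Measure.map_map (measurable_precomp _) (measurable_precomp _)]
  have h1 := map_precomp_lebesgue (add_left_injective (QuotientAddGroup.mk g : D ⧸ subDSigma σ))
  conv_rhs => rw [← h1]
  rw [Measure.map_map (measurable_precomp _) (measurable_precomp _)]
  rfl

theorem measurePreserving_diag (σ : ℕ → Fin 2) (g : D) :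
    MeasurePreserving (fun x : Config × BinSeq => g +ᵥ x) (omegaSigma σ) (omegaSigma σ) :=
  (measurePreserving_shift_mSigma σ g).prod (measurePreserving_add_lebesgue (tau g))

/-- Almost all configurations are constant on the classes modulo `𝒟^σ`. -/
theorem ae_apply_trunc (σ : ℕ → Fin 2) :
    ∀ᵐ x ∂omegaSigma σ, ∀ g, x.1 (trunc σ g) = x.1 g := by
  have h : ∀ᵐ w ∂mSigma σ, ∀ g, w (trunc σ g) = w g := by
    refine (ae_map_iff (measurable_precomp _).aemeasurable ?_).2 (ae_of_all _ fun u g => ?_)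
    · refine MeasurableSet.congr (s := ⋂ g, {w : Config | w (trunc σ g) = w g})
        (MeasurableSet.iInter fun g => measurableSet_eq_fun (measurable_pi_apply _)
          (measurable_pi_apply _)) ?_
      ext w
      simp
    · exact congrArg u (mk_trunc σ g)
  exact Measure.quasiMeasurePreserving_fst.ae h

/-- The values of a random configuration at representatives of the classes modulo `𝒟^σ` are
independent and uniformly distributed. -/
theorem map_reps_omegaSigma (σ : ℕ → Fin 2) (n : ℕ) :
    (omegaSigma σ).map (fun x (q : reps σ n) => x.1 q) = Measure.pi fun _ => coin := by
  have h1 : (omegaSigma σ).map (fun x (q : reps σ n) => x.1 q) =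
      (mSigma σ).map (fun w (q : reps σ n) => w q) := by
    have := Measure.map_map (μ := omegaSigma σ) (measurable_precomp fun q : reps σ n => (q : D))
      measurable_fst
    refine this.symm.trans ?_
    congr 1
    exact Measure.map_fst_prod.trans (by simp)
  rw [h1, mSigma, Measure.map_map (measurable_precomp _) (measurable_precomp _)]
  -- Distinct representatives lie in distinct classes, so distinct coordinates of the Bernoulli
  -- measure are read.
  refine (map_precomp_lebesgue (f := fun q : reps σ n =>
    (QuotientAddGroup.mk (q : D) : D ⧸ subDSigma σ)) fun p q hpq => ?_).trans
    (Measure.infinitePi_eq_pi _)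
  have := trunc_eq_of_mk_eq hpq
  rw [(mem_reps.1 p.2).2, (mem_reps.1 q.2).2] at this
  exact Subtype.ext this

/-- The measure of a ball of small radius in the Hamming distance. -/
theorem omegaSigma_hamming_ball_le (σ : ℕ → Fin 2) (n : ℕ) (w : Config) :
    (omegaSigma σ).real {x | 16 * ((reps σ n).filter fun q => x.1 q ≠ w q).card ≤
      (reps σ n).card} ≤ (13 / 20) ^ (reps σ n).card := by
  let v : reps σ n → ZMod 2 := fun q => w q
  let A : Finset (reps σ n → ZMod 2) := Finset.univ.filter fun u =>
      16 * (Finset.univ.filter fun i => u i ≠ v i).card ≤ Fintype.card (reps σ n)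
  have hA : {x : Config × BinSeq | 16 * ((reps σ n).filter fun q => x.1 q ≠ w q).card ≤
      (reps σ n).card} = (fun x (q : reps σ n) => x.1 q) ⁻¹' (A : Set (reps σ n → ZMod 2)) := by
    ext x
    have : ((reps σ n).filter fun q => x.1 q ≠ w q).card =
        (Finset.univ.filter fun i : reps σ n => x.1 i ≠ v i).card := by
      rw [Finset.card_filter, Finset.card_filter]
      exact (Finset.sum_coe_sort (reps σ n) fun q => if x.1 q ≠ w q then 1 else 0).symm
    simp only [Set.mem_ofPred_eq, Set.mem_preimage, A, Finset.coe_filter, Finset.mem_univ,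
      true_and, Fintype.card_coe, this]
  have hm : Measurable (fun (x : Config × BinSeq) (q : reps σ n) => x.1 q) :=
    (measurable_precomp _).comp measurable_fst
  rw [hA, ← map_measureReal_apply hm A.measurableSet, map_reps_omegaSigma]
  have hs : ∀ u : reps σ n → ZMod 2,
      (Measure.pi fun _ : reps σ n => coin).real {u} = (1 / 2) ^ (reps σ n).card := by
    intro u
    rw [measureReal_def, Measure.pi_singleton]
    simp [coin_singleton]
  rw [← sum_measureReal_singleton, Finset.sum_congr rfl fun u _ => hs u, Finset.sum_const,
    nsmul_eq_mul]
  have h := card_hamming_ball_le v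
  rw [Fintype.card_coe] at h
  have h' : (A.card : ℝ) ≤ (13 / 10) ^ (reps σ n).card := by
    simpa only [A, Fintype.card_coe] using h
  calc _ ≤ (13 / 10 : ℝ) ^ (reps σ n).card * (1 / 2) ^ (reps σ n).card := by gcongr
    _ = _ := by rw [← mul_pow]; norm_num

end OrderedPairs

/-! ### Entropy bounds for the diagonal action -/

namespace OrderedPairs

/-- Two points of `{0, 1}^𝒟 × {0, 1}^ℕ` coincide on `𝒟_m` and in the first `m` coordinates. -/
def Agree (m : ℕ) (x y : Config × BinSeq) : Prop :=
  (∀ h ∈ equipD m, x.1 h = y.1 h) ∧ ∀ i < m, x.2 i = y.2 i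

theorem equipD_mono {m n : ℕ} (hmn : m ≤ n) : equipD m ⊆ equipD n := fun _ hg =>
  mem_equipD.2 fun i hi => mem_equipD.1 hg i (hmn.trans hi)

theorem Agree.mono {m n : ℕ} (hmn : m ≤ n) {x y : Config × BinSeq} (h : Agree n x y) :
    Agree m x y :=
  ⟨fun g hg => h.1 g (equipD_mono hmn hg), fun i hi => h.2 i (hi.trans_le hmn)⟩

/-- The measurable sets determined by finitely many coordinates. -/
def localSets : Set (Set (Config × BinSeq)) :=
  {U | MeasurableSet U ∧ ∃ m, ∀ x y, Agree m x y → (x ∈ U ↔ y ∈ U)}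

theorem isSetAlgebra_localSets : IsSetAlgebra localSets where
  empty_mem := ⟨MeasurableSet.empty, 0, fun _ _ _ => Iff.rfl⟩
  compl_mem := by
    rintro U ⟨hU, m, hm⟩
    exact ⟨hU.compl, m, fun x y h => not_congr (hm x y h)⟩
  union_mem := by
    rintro U V ⟨hU, m, hm⟩ ⟨hV, n, hn⟩
    exact ⟨hU.union hV, max m n, fun x y h => or_congr (hm x y (h.mono (le_max_left m n)))
      (hn x y (h.mono (le_max_right m n)))⟩

theorem generateFrom_localSets :
    (inferInstance : MeasurableSpace (Config × BinSeq)) =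
      MeasurableSpace.generateFrom localSets := by
  refine le_antisymm ?_ (MeasurableSpace.generateFrom_le fun U hU => hU.1)
  have h1 : ∀ g : D, Measurable[MeasurableSpace.generateFrom localSets]
      (fun x : Config × BinSeq => x.1 g) := by
    intro g s hs
    refine MeasurableSpace.measurableSet_generateFrom
      ⟨((measurable_pi_apply g).comp measurable_fst) hs, len g, fun x y h => ?_⟩
    have hxy : x.1 g = y.1 g := h.1 g (mem_equipD.2 fun i hi => apply_eq_zero_of_len_le hi)
    simp only [Set.mem_preimage, hxy]
  have h2 : ∀ i : ℕ, Measurable[MeasurableSpace.generateFrom localSets]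
      (fun x : Config × BinSeq => x.2 i) := by
    intro i s hs
    refine MeasurableSpace.measurableSet_generateFrom
      ⟨((measurable_pi_apply i).comp measurable_snd) hs, i + 1, fun x y h => ?_⟩
    have hxy : x.2 i = y.2 i := h.2 i (Nat.lt_succ_self i)
    simp only [Set.mem_preimage, hxy]
  have h3 : Measurable[MeasurableSpace.generateFrom localSets]
      (fun x : Config × BinSeq => (x.1, x.2)) :=
    Measurable.prodMk (f := fun x : Config × BinSeq => x.1) (g := fun x => x.2)
      (@measurable_pi_lambda _ _ _ (MeasurableSpace.generateFrom localSets) _ _ h1)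
      (@measurable_pi_lambda _ _ _ (MeasurableSpace.generateFrom localSets) _ _ h2)
  exact fun s hs => h3 hs

/-- Sets depending on finitely many coordinates form an algebra that generates the `σ`-algebra,
hence are dense in measure. This supplies the approximation hypothesis of
`IsSummableAdmissibleMetric.exists_local_bound` for the relations `Agree m`. -/
theorem exists_local_approximation (μ : Measure (Config × BinSeq)) [IsFiniteMeasure μ]
    (V : Set (Config × BinSeq)) (hV : MeasurableSet V) (η : ℝ) (hη : 0 < η) :
    ∃ m, ∃ U : Set (Config × BinSeq), MeasurableSet U ∧
      (∀ x y, Agree m x y → (x ∈ U ↔ y ∈ U)) ∧ μ (symmDiff V U) < ENNReal.ofReal η := by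
  obtain ⟨U, ⟨hU, m, hm⟩, h⟩ := (Measure.MeasureDense.of_generateFrom_isSetAlgebra_finite (μ := μ)
    isSetAlgebra_localSets generateFrom_localSets).approx V hV (measure_ne_top _ _) η hη
  exact ⟨m, U, hU, hm, h⟩

theorem diag_fst (g : D) (x : Config × BinSeq) (h : D) : (g +ᵥ x).1 h = x.1 (h + g) := rfl

theorem diag_snd (g : D) (x : Config × BinSeq) (i : ℕ) : (g +ᵥ x).2 i = x.2 i + g i := rfl

/-- The values at representatives of the classes modulo `𝒟^σ` determine the values on `𝒟_n` of all
shifts by the elements of `𝒟_n`. -/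
theorem agree_shift {σ : ℕ → Fin 2} {m n : ℕ} (hmn : m ≤ n) {x y : Config × BinSeq}
    (hx : ∀ g, x.1 (trunc σ g) = x.1 g) (hy : ∀ g, y.1 (trunc σ g) = y.1 g)
    (h₁ : ∀ q ∈ reps σ n, x.1 q = y.1 q) (h₂ : ∀ i < m, x.2 i = y.2 i) {g : D}
    (hg : g ∈ equipD n) : Agree m (g +ᵥ x) (g +ᵥ y) := by
  refine ⟨fun h hh => ?_, fun i hi => by rw [diag_snd, diag_snd, h₂ i hi]⟩
  rw [diag_fst, diag_fst, ← hx, ← hy]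
  exact h₁ _ (trunc_mem_reps (add_mem_equipD (equipD_mono hmn hh) hg))

/-- The upper bound for the entropy of the averaged metrics. -/
theorem exists_epsEntropy_le (σ : ℕ → Fin 2) {ρ : Config × BinSeq → Config × BinSeq → ℝ}
    (hρ : IsSummableAdmissibleMetric (omegaSigma σ) ρ) {ε : ℝ} (hε : 0 < ε) :
    ∃ m : ℕ, ∀ n, m ≤ n → epsEntropy (omegaSigma σ) (averageOver (equipD n) ρ) ε ≤
      ENNReal.ofReal ((m + 1) * 2 ^ ∑ i ∈ Finset.range n, (σ i : ℕ)) := by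
  -- The bound `ε / 4` leads to diameter at most `3 * ε / 4`; the bound `ε ^ 2 / 8`, through
  -- Markov's inequality at level `ε / 4`, gives an exceptional set of measure less than `ε / 2`.
  obtain ⟨m, φ, hφ0, hφ, hφi, hloc⟩ := hρ.exists_local_bound
    (R := Agree) (fun m n hmn x y h => Agree.mono hmn h) (exists_local_approximation (omegaSigma σ))
    (lt_min (by positivity : 0 < ε / 4) (by positivity : 0 < ε ^ 2 / 8))
  refine ⟨m, fun n hn => ?_⟩
  set N := 2 ^ ∑ i ∈ Finset.range n, (σ i : ℕ) with hN
  have hcard0 : ((equipD n).card : ℝ) ≠ 0 :=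
    Nat.cast_ne_zero.2 (Finset.card_pos.2 (equipD_nonempty n)).ne'
  obtain ⟨hZm, hZ⟩ := markov_average (measurePreserving_diag σ) (equipD_nonempty n) hφ hφ0
    (by positivity : 0 < ε / 4)
  set Z := {x : Config × BinSeq | ε / 4 ≤ ((equipD n).card : ℝ)⁻¹ * ∑ g ∈ equipD n, φ (g +ᵥ x)}
  set Y : Set (Config × BinSeq) := {x | ∀ g, x.1 (trunc σ g) = x.1 g}ᶜ
  have hY : omegaSigma σ Y = 0 := ae_apply_trunc σ
  have hmeas : omegaSigma σ (Z ∪ Y) < ENNReal.ofReal ε := by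
    refine (measure_union_le _ _).trans_lt ?_
    rw [hY, add_zero, ← ofReal_measureReal]
    refine (ENNReal.ofReal_lt_ofReal_iff hε).2 (hZ.trans_lt ?_)
    rw [div_lt_iff₀ (by positivity)]
    have := hφi.trans_le (min_le_right _ _)
    nlinarith
  -- The code of a point: its bits at the representatives and the first `m` terms of its sequence.
  -- It takes `2 ^ (N + m)` values.
  let c : Config × BinSeq → (reps σ n → ZMod 2) × (Fin m → ZMod 2) :=
    fun x => (fun q => x.1 q, fun i => x.2 i)
  have hc : Measurable c := ((measurable_precomp fun q : reps σ n => (q : D)).comp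
    measurable_fst).prodMk ((measurable_precomp fun i : Fin m => (i : ℕ)).comp measurable_snd)
  have hpart : HasSmallPartition (omegaSigma σ) (averageOver (equipD n) ρ) ε
      (Fintype.card ((reps σ n → ZMod 2) × (Fin m → ZMod 2))) := by
    refine HasSmallPartition.of_map hc (hZm.union (NullMeasurableSet.of_null hY)) hmeas
      (d := ε / 4 + ε / 4 + ε / 4) (by linarith) fun x y hx hy hxy => ?_
    simp only [Set.mem_union, not_or] at hx hy
    have hx1 : ((equipD n).card : ℝ)⁻¹ * ∑ g ∈ equipD n, φ (g +ᵥ x) < ε / 4 :=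
      lt_of_not_ge hx.1
    have hy1 : ((equipD n).card : ℝ)⁻¹ * ∑ g ∈ equipD n, φ (g +ᵥ y) < ε / 4 :=
      lt_of_not_ge hy.1
    have h1 : ∀ q ∈ reps σ n, x.1 q = y.1 q := fun q hq =>
      congrFun (congrArg Prod.fst hxy) ⟨q, hq⟩
    have h2 : ∀ i < m, x.2 i = y.2 i := fun i hi => congrFun (congrArg Prod.snd hxy) ⟨i, hi⟩
    have h3 : ∑ g ∈ equipD n, ρ (g +ᵥ x) (g +ᵥ y) ≤
        ∑ g ∈ equipD n, (ε / 4 + φ (g +ᵥ x) + φ (g +ᵥ y)) := by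
      refine Finset.sum_le_sum fun g hg => ?_
      have := hloc _ _ (agree_shift hn (not_not.1 hx.2) (not_not.1 hy.2) h1 h2 hg)
      linarith [min_le_left (ε / 4) (ε ^ 2 / 8)]
    rw [Finset.sum_add_distrib, Finset.sum_add_distrib, Finset.sum_const, nsmul_eq_mul] at h3
    have h4 := mul_le_mul_of_nonneg_left h3
      (inv_nonneg.2 (Nat.cast_nonneg (α := ℝ) (equipD n).card))
    rw [mul_add, mul_add, inv_mul_cancel_left₀ hcard0] at h4
    exact h4.trans (by linarith)
  have hk : Fintype.card ((reps σ n → ZMod 2) × (Fin m → ZMod 2)) = 2 ^ (N + m) := by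
    rw [Fintype.card_prod, Fintype.card_fun, Fintype.card_fun, ZMod.card, Fintype.card_coe,
      Fintype.card_fin, card_reps, pow_add]
  rw [hk] at hpart
  refine (epsEntropy_le (by positivity) hpart).trans (ENNReal.ofReal_le_ofReal ?_)
  -- Since `N ≥ 1`, one has `N + m ≤ (m + 1) * N`. The factor `m + 1` depends on `ε`, which is
  -- harmless, as `ε` is fixed while `n` grows.
  have hN1 : (1 : ℝ) ≤ 2 ^ ∑ i ∈ Finset.range n, (σ i : ℕ) := one_le_pow₀ (by norm_num)
  rw [Nat.cast_pow, Nat.cast_ofNat, Real.logb_pow, Real.logb_self_eq_one (by norm_num), mul_one,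
    hN, Nat.cast_add, Nat.cast_pow, Nat.cast_ofNat]
  nlinarith [(Nat.cast_nonneg m : (0 : ℝ) ≤ m)]

/-- The lower bound for the entropy of the averaged metrics. -/
theorem exists_le_epsEntropy (σ : ℕ → Fin 2) {ρ : Config × BinSeq → Config × BinSeq → ℝ}
    (hρ : IsSummableAdmissibleMetric (omegaSigma σ) ρ) :
    ∃ ε₀ : ℝ, 0 < ε₀ ∧ ∀ ε : ℝ, ε < ε₀ → ∀ n,
      ENNReal.ofReal (Real.logb 2 (23 / 20) * 2 ^ ∑ i ∈ Finset.range n, (σ i : ℕ)) ≤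
        epsEntropy (omegaSigma σ) (averageOver (equipD n) ρ) ε := by
  have hE : MeasurableSet {x : Config × BinSeq | x.1 0 = 0} :=
    measurableSet_eq_fun ((measurable_pi_apply (0 : D)).comp measurable_fst) measurable_const
  -- With `1 / 512`, Markov's inequality at level `1 / 64` gives an exceptional set of measure at
  -- most `1 / 8`.
  obtain ⟨δ, hδ, B, hBm, hB, hsep⟩ :=
    hρ.exists_separation hE (by norm_num : (0 : ℝ) < 1 / 512)
  have hsep' : ∀ x y, x ∉ B → y ∉ B → x.1 0 ≠ y.1 0 → δ ≤ ρ x y := by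
    intro x y hx hy hxy
    by_cases hx0 : x.1 0 = 0
    · exact hsep x y hx hy hx0 fun hy0 => hxy (hx0.trans hy0.symm)
    · have hy0 : y.1 0 = 0 := by
        generalize x.1 0 = a at hx0 hxy
        generalize y.1 0 = b at hxy
        revert a b
        decide
      rw [hρ.semimetric.symm]
      exact hsep y x hy hx hy0 hx0
  let β : Config × BinSeq → ℝ := B.indicator fun _ => 1
  have hβ0 : ∀ x, 0 ≤ β x := fun x => Set.indicator_nonneg (fun _ _ => zero_le_one) x
  have hβi : Integrable β (omegaSigma σ) := (integrable_const (1 : ℝ)).indicator hBm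
  have hβint : ∫ x, β x ∂omegaSigma σ = (omegaSigma σ).real B := by
    simp [β, integral_indicator_const _ hBm]
  -- The separation made valid for all pairs: a point of `B` pays the missing `δ`.
  have hlow : ∀ x y, δ * (if x.1 0 ≠ y.1 0 then 1 else 0) ≤ ρ x y + δ * β x + δ * β y := by
    intro x y
    have h1 := hρ.semimetric.nonneg x y
    have h2 := mul_nonneg hδ.le (hβ0 x)
    have h3 := mul_nonneg hδ.le (hβ0 y)
    split_ifs with hxy
    · by_cases hx : x ∈ B
      · have : β x = 1 := by simp [β, hx]
        rw [this] at h2 ⊢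
        linarith
      by_cases hy : y ∈ B
      · have : β y = 1 := by simp [β, hy]
        rw [this] at h3 ⊢
        linarith
      linarith [hsep' x y hx hy hxy]
    · linarith
  -- Off the exceptional sets, `δ` times the proportion of differing bits is less than `ε + δ / 64 +
  -- δ / 64`, hence at most `δ / 16`, the radius in the Hamming ball estimate. The bound `1 / 8`
  -- limits the measure of `A 0`.
  refine ⟨min (δ / 32) (1 / 8), by positivity, fun ε hε n => le_epsEntropy fun k hk hpart => ?_⟩
  have hε1 := hε.trans_le (min_le_left _ _)
  have hε2 := hε.trans_le (min_le_right _ _)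
  set N := (reps σ n).card with hN
  have hNpos : 0 < N := by rw [hN, card_reps]; positivity
  obtain ⟨-, hZ⟩ := markov_average (measurePreserving_diag σ) (equipD_nonempty n) hβi hβ0
    (by norm_num : (0 : ℝ) < 1 / 64)
  set Z := {x : Config × BinSeq | 1 / 64 ≤ ((equipD n).card : ℝ)⁻¹ * ∑ g ∈ equipD n, β (g +ᵥ x)}
  set Y : Set (Config × BinSeq) := {x | ∀ g, x.1 (trunc σ g) = x.1 g}ᶜ
  have hY : (omegaSigma σ).real Y = 0 := by
    rw [measureReal_def, (ae_apply_trunc σ : omegaSigma σ Y = 0), ENNReal.toReal_zero]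
  have hZ' : (omegaSigma σ).real Z ≤ 1 / 8 := by
    refine hZ.trans ?_
    rw [hβint, div_le_iff₀ (by norm_num)]
    linarith
  -- Points of a set of small diameter are close in the Hamming distance.
  have hclose : ∀ x y, x ∉ Z ∪ Y → y ∉ Z ∪ Y → averageOver (equipD n) ρ x y < ε →
      16 * ((reps σ n).filter fun q => x.1 q ≠ y.1 q).card ≤ N := by
    intro x y hx hy hxy
    simp only [Set.mem_union, not_or] at hx hy
    have hx1 : ((equipD n).card : ℝ)⁻¹ * ∑ g ∈ equipD n, β (g +ᵥ x) < 1 / 64 :=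
      lt_of_not_ge hx.1
    have hy1 : ((equipD n).card : ℝ)⁻¹ * ∑ g ∈ equipD n, β (g +ᵥ y) < 1 / 64 :=
      lt_of_not_ge hy.1
    have hx2 : ∀ g, x.1 (trunc σ g) = x.1 g := not_not.1 hx.2
    have hy2 : ∀ g, y.1 (trunc σ g) = y.1 g := not_not.1 hy.2
    have h1 : ∑ g ∈ equipD n, δ * (if x.1 (trunc σ g) ≠ y.1 (trunc σ g) then (1 : ℝ) else 0) ≤
        ∑ g ∈ equipD n, (ρ (g +ᵥ x) (g +ᵥ y) + δ * β (g +ᵥ x) + δ * β (g +ᵥ y)) := by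
      refine Finset.sum_le_sum fun g _ => ?_
      have := hlow (g +ᵥ x) (g +ᵥ y)
      rwa [diag_fst, diag_fst, zero_add, ← hx2, ← hy2] at this
    have h2 := mul_le_mul_of_nonneg_left h1
      (inv_nonneg.2 (Nat.cast_nonneg (α := ℝ) (equipD n).card))
    -- The average over `𝒟_n` becomes the proportion of representatives at which the two
    -- configurations differ.
    rw [average_trunc σ n fun q => δ * (if x.1 q ≠ y.1 q then (1 : ℝ) else 0), ← Finset.mul_sum,
      Finset.sum_boole, Finset.sum_add_distrib, Finset.sum_add_distrib, ← Finset.mul_sum,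
      ← Finset.mul_sum, mul_add, mul_add, mul_left_comm _ δ, mul_left_comm _ δ] at h2
    have h3 : δ * ((N : ℝ)⁻¹ * ((reps σ n).filter fun q => x.1 q ≠ y.1 q).card) ≤
        δ * (1 / 16) := by
      have hx3 := mul_le_mul_of_nonneg_left hx1.le hδ.le
      have hy3 := mul_le_mul_of_nonneg_left hy1.le hδ.le
      have hxy' : ((equipD n).card : ℝ)⁻¹ * ∑ g ∈ equipD n, ρ (g +ᵥ x) (g +ᵥ y) < ε := hxy
      rw [mul_left_comm _ δ] at h2
      linarith
    have h4 := le_of_mul_le_mul_left h3 hδ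
    rw [inv_mul_le_iff₀ (by exact_mod_cast hNpos)] at h4
    have h5 : (16 : ℝ) * ((reps σ n).filter fun q => x.1 q ≠ y.1 q).card ≤ N := by linarith
    exact_mod_cast h5
  obtain ⟨A, -, -, hcover, hA0, hdiam⟩ := hpart
  have hA0' : (omegaSigma σ).real (A 0) ≤ 1 / 8 :=
    ENNReal.toReal_le_of_le_ofReal (by norm_num)
      (hA0.le.trans (ENNReal.ofReal_le_ofReal hε2.le))
  have hsmall : ∀ j : Fin k,
      (omegaSigma σ).real (A j.succ \ (Z ∪ Y)) ≤ (13 / 20) ^ N := by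
    intro j
    rcases (A j.succ \ (Z ∪ Y)).eq_empty_or_nonempty with h | ⟨y, hyA, hy⟩
    · rw [h, measureReal_empty]
      positivity
    -- The centre of the Hamming ball is a point of the piece itself, taken off the exceptional
    -- sets.
    · refine (measureReal_mono fun x hx => ?_).trans (omegaSigma_hamming_ball_le σ n y.1)
      obtain ⟨d, hd, hAd⟩ := hdiam j.succ (Fin.succ_ne_zero j)
      exact hclose x y hx.2 hy ((hAd x hx.1 y hyA).trans_lt hd)
  -- The sets `A 0` and `Z` take at most `1 / 8` each and `Y` is null, so the `k` pieces cover at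
  -- least `3 / 4`.
  have hmass : 3 / 4 ≤ (k : ℝ) * (13 / 20) ^ N := by
    have h1 : (Set.univ : Set (Config × BinSeq)) ⊆
        (A 0 ∪ (Z ∪ Y)) ∪ ⋃ j ∈ (Finset.univ : Finset (Fin k)), (A j.succ \ (Z ∪ Y)) := by
      intro x _
      by_cases hx : x ∈ Z ∪ Y
      · exact Or.inl (Or.inr hx)
      obtain ⟨j, hj⟩ := Set.mem_iUnion.1 (hcover.symm ▸ Set.mem_univ x : x ∈ ⋃ j, A j)
      rcases Fin.eq_zero_or_eq_succ j with rfl | ⟨i, rfl⟩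
      · exact Or.inl (Or.inl hj)
      · exact Or.inr (Set.mem_biUnion (Finset.mem_coe.2 (Finset.mem_univ i)) ⟨hj, hx⟩)
    have h2 := measureReal_mono (μ := omegaSigma σ) h1
    rw [probReal_univ] at h2
    have h3 := measureReal_union_le (μ := omegaSigma σ) (A 0 ∪ (Z ∪ Y))
      (⋃ j ∈ (Finset.univ : Finset (Fin k)), (A j.succ \ (Z ∪ Y)))
    have h4 := measureReal_union_le (μ := omegaSigma σ) (A 0) (Z ∪ Y)
    have h5 := measureReal_union_le (μ := omegaSigma σ) Z Y
    have h6 := measureReal_biUnion_finset_le (μ := omegaSigma σ) (Finset.univ : Finset (Fin k))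
      (fun j => A j.succ \ (Z ∪ Y))
    have h7 := Finset.sum_le_sum fun j (_ : j ∈ (Finset.univ : Finset (Fin k))) => hsmall j
    rw [Finset.sum_const, Finset.card_univ, Fintype.card_fin, nsmul_eq_mul] at h7
    linarith
  -- The base `23 / 20` is chosen so that `23/20 * 13/20 = 299/400 ≤ 3/4`; since `N ≥ 1`, a single
  -- factor already absorbs the constant.
  have hkN : (23 / 20 : ℝ) ^ N ≤ k := by
    refine le_of_mul_le_mul_right (le_trans ?_ hmass) (by positivity : (0 : ℝ) < (13 / 20) ^ N)
    rw [← mul_pow]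
    calc _ ≤ (23 / 20 * (13 / 20) : ℝ) ^ 1 :=
          pow_le_pow_of_le_one (by norm_num) (by norm_num) hNpos
      _ ≤ 3 / 4 := by norm_num
  have h8 : Real.logb 2 ((23 / 20) ^ N) ≤ Real.logb 2 k :=
    Real.logb_le_logb_of_le (by norm_num) (by positivity) hkN
  rw [Real.logb_pow, hN, card_reps, Nat.cast_pow, Nat.cast_ofNat] at h8
  rwa [mul_comm]

theorem isScalingSequence_omegaSigma (σ : ℕ → Fin 2) :
    IsScalingSequence (omegaSigma σ) equipD
      (fun n => (2 : ℝ) ^ (∑ i ∈ Finset.range n, (σ i : ℕ))) where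
  measurePreserving := measurePreserving_diag σ
  pos _ _ := by positivity
  exists_metric := exists_isSummableAdmissibleMetric _
  scaling ρ hρ := by
    obtain ⟨ε₀, hε₀, hlow⟩ := exists_le_epsEntropy σ hρ
    refine ⟨ε₀, hε₀, fun ε hε hεε₀ => ?_⟩
    obtain ⟨m, hup⟩ := exists_epsEntropy_le σ hρ hε
    exact AsympEquiv.of_bounds (fun n => by positivity)
      (Real.logb_pos (by norm_num) (by norm_num)) (Eventually.of_forall (hlow ε hεε₀))
      ((eventually_ge_atTop m).mono hup)

end OrderedPairs

/-! ### Invariance under isomorphism -/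

section Transfer

variable {X Y : Type*} [MeasurableSpace X] [MeasurableSpace Y] {μ : Measure X} {ν : Measure Y}

theorem IsSummableAdmissibleMetric.comp_equiv [SFinite μ] [SFinite ν] (e : X ≃ᵐ Y)
    (he : MeasurePreserving e μ ν) {ρ : Y → Y → ℝ} (hρ : IsSummableAdmissibleMetric ν ρ) :
    IsSummableAdmissibleMetric μ (fun x y => ρ (e x) (e y)) := by
  have hee := he.prod he
  refine ⟨⟨⟨fun x y => hρ.semimetric.nonneg _ _, fun x => hρ.semimetric.self _,
    fun x y => hρ.semimetric.symm _ _, fun x y z => hρ.semimetric.triangle _ _ _⟩,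
    hρ.measurable.comp_quasiMeasurePreserving hee.quasiMeasurePreserving, ?_⟩,
    hee.integrable_comp_of_integrable hρ.summable⟩
  obtain ⟨Y₀, h0, ⟨S, hS, hSY, hd⟩, hm⟩ := hρ.exists_full
  refine ⟨e ⁻¹' Y₀, he.quasiMeasurePreserving.preimage_null h0, ⟨e ⁻¹' S,
    hS.preimage e.injective, Set.preimage_mono hSY, fun x hx δ hδ => ?_⟩,
    fun x hx y hy h => e.injective (hm _ hx _ hy h)⟩
  obtain ⟨s, hs, h⟩ := hd (e x) hx δ hδ
  exact ⟨e.symm s, by simpa using hs, by simpa using h⟩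

theorem HasSmallPartition.comp_equiv (e : X ≃ᵐ Y) (he : MeasurePreserving e μ ν)
    {ρ : Y → Y → ℝ} {ε : ℝ} {k : ℕ} (h : HasSmallPartition ν ρ ε k) :
    HasSmallPartition μ (fun x y => ρ (e x) (e y)) ε k := by
  obtain ⟨A, hA, hd, hc, h0, hdiam⟩ := h
  refine ⟨fun j => e ⁻¹' A j, fun j => (hA j).preimage he.quasiMeasurePreserving,
    fun i j hij => (hd hij).preimage e, by rw [← Set.preimage_iUnion, hc, Set.preimage_univ],
    by rwa [he.measure_preimage (hA 0)], fun j hj => ?_⟩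
  obtain ⟨d, hdε, hd⟩ := hdiam j hj
  exact ⟨d, hdε, fun x hx y hy => hd _ hx _ hy⟩

theorem epsEntropy_comp_equiv (e : X ≃ᵐ Y) (he : MeasurePreserving e μ ν) (ρ : Y → Y → ℝ)
    (ε : ℝ) : epsEntropy μ (fun x y => ρ (e x) (e y)) ε = epsEntropy ν ρ ε := by
  have h : ∀ k, HasSmallPartition μ (fun x y => ρ (e x) (e y)) ε k ↔
      HasSmallPartition ν ρ ε k := fun k => by
    refine ⟨fun h => ?_, fun h => h.comp_equiv e he⟩
    simpa using h.comp_equiv e.symm (he.symm e)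
  simp only [epsEntropy, h]

/-- Scaling sequences are invariant under isomorphisms of actions. -/
theorem IsScalingSequence.of_equiv {G : Type*} [AddGroup G] [AddAction G X] [AddAction G Y]
    [SFinite μ] [SFinite ν] (e : X ≃ᵐ Y) (he : MeasurePreserving e μ ν)
    (hG : ∀ (g : G) (x : X), e (g +ᵥ x) = g +ᵥ e x) {E : ℕ → Finset G} {h : ℕ → ℝ}
    (H : IsScalingSequence ν E h) : IsScalingSequence μ E h where
  measurePreserving g := by
    have h1 : (fun x : X => g +ᵥ x) = e.symm ∘ (fun y : Y => g +ᵥ y) ∘ e := by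
      funext x
      simp [← hG]
    rw [h1]
    exact (he.symm e).comp ((H.measurePreserving g).comp he)
  pos := H.pos
  exists_metric := by
    obtain ⟨ρ, hρ⟩ := H.exists_metric
    exact ⟨_, hρ.comp_equiv e he⟩
  scaling ρ hρ := by
    obtain ⟨ε₀, hε₀, hs⟩ := H.scaling _ (hρ.comp_equiv e.symm (he.symm e))
    refine ⟨ε₀, hε₀, fun ε hε hεε₀ => ?_⟩
    -- By equivariance, averaging commutes with transporting the metric along `e`.
    have h1 : ∀ n, averageOver (E n) ρ = fun x y =>
        averageOver (E n) (fun x y => ρ (e.symm x) (e.symm y)) (e x) (e y) := by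
      intro n
      funext x y
      simp only [averageOver, ← hG, MeasurableEquiv.symm_apply_apply]
    simp only [h1, epsEntropy_comp_equiv e he]
    exact hs ε hε hεε₀

end Transfer

/-! ### `Ψ` as an isomorphism between the canonical and the diagonal action -/

namespace OrderedPairs

/-- The value at `g` is a function of one vertex and finitely many indices, which together range
over a finite discrete space. -/
theorem measurable_F_apply (g : D) : Measurable (fun x : PathSpace => F x g) := by
  have hc : Measurable (fun x : PathSpace => (x.vertex, x.index)) := comap_measurable _
  have hv : Measurable (fun x : PathSpace => x.vertex (len g)) :=
    (measurable_pi_apply (len g)).comp (measurable_fst.comp hc)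
  have hi : Measurable (fun x : PathSpace => fun i : Fin (len g) => x.index i) :=
    (measurable_precomp fun i : Fin (len g) => (i : ℕ)).comp (measurable_snd.comp hc)
  have : Finite (Vertex (len g)) := finite_vertex _
  have : DiscreteMeasurableSpace (Vertex (len g)) := ⟨fun _ => trivial⟩
  have h1 : Measurable (fun q : Vertex (len g) × (Fin (len g) → ZMod 2) =>
      Phi (len g) q.1 (g + ∑ i : Fin (len g), Finsupp.single (i : ℕ) (q.2 i))) :=
    measurable_of_countable _
  have h2 := h1.comp (hv.prodMk hi)
  simp only [F, partialSum, Finset.sum_range]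
  exact h2

/-- The map `Ψ` as an isomorphism of measurable spaces. -/
noncomputable def psiMeasurableEquiv : PathSpace ≃ᵐ Config × BinSeq where
  toEquiv := psiEquiv
  measurable_toFun := (measurable_pi_lambda _ measurable_F_apply).prodMk
    (measurable_snd.comp (comap_measurable fun x : PathSpace => (x.vertex, x.index)))
  measurable_invFun := measurable_psiEquiv_symm

theorem measurePreserving_psi (σ : ℕ → Fin 2) :
    MeasurePreserving psiMeasurableEquiv (muSigma σ) (omegaSigma σ) := by
  have h : MeasurePreserving psiMeasurableEquiv.symm (omegaSigma σ) (muSigma σ) :=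
    ⟨measurable_psiEquiv_symm, rfl⟩
  exact h.symm psiMeasurableEquiv.symm

/-- The map `Ψ` takes the canonical action to the diagonal one. -/
theorem psi_vadd (g : D) (x : PathSpace) : psi (g +ᵥ x) = g +ᵥ psi x := by
  refine Prod.ext (funext fun h => ?_) rfl
  change F (kappa g x) h = F x (h + g)
  -- On so high a floor `κ(g)` does not change the vertex, so both sides are values of `Φ` for the
  -- same vertex; below `n` the arguments agree by commutativity.
  set n := max (len h) (max (len g) (len (h + g)))
  have hg : len g ≤ n := (le_max_left _ _).trans (le_max_right _ _)
  rw [F_eq _ h n (le_max_left _ _),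
    F_eq _ (h + g) n ((le_max_right _ _).trans (le_max_right _ _)), kappa_vertex_of_le g x n hg]
  refine Phi_congr n _ fun i hi => ?_
  rw [Finsupp.add_apply, Finsupp.add_apply, Finsupp.add_apply, partialSum_apply_of_lt _ hi,
    partialSum_apply_of_lt _ hi, kappa_index]
  change h i + (x.index i + g i) = h i + g i + x.index i
  ring

end OrderedPairs

theorem corollary7 (σ : ℕ → Fin 2) :
    IsScalingSequence (OrderedPairs.omegaSigma σ) OrderedPairs.equipD
        (fun n => (2 : ℝ) ^ (∑ i ∈ Finset.range n, (σ i : ℕ))) ∧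
      IsScalingSequence (OrderedPairs.muSigma σ) OrderedPairs.equipD
        (fun n => (2 : ℝ) ^ (∑ i ∈ Finset.range n, (σ i : ℕ))) := by
  have hμ : IsProbabilityMeasure (OrderedPairs.muSigma σ) :=
    Measure.isProbabilityMeasure_map OrderedPairs.measurable_psiEquiv_symm.aemeasurable
  exact ⟨OrderedPairs.isScalingSequence_omegaSigma σ,
    (OrderedPairs.isScalingSequence_omegaSigma σ).of_equiv OrderedPairs.psiMeasurableEquiv
      (OrderedPairs.measurePreserving_psi σ) OrderedPairs.psi_vadd⟩
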